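/- Let $\mathbb T$ be the unit circle, $1<p<\infty$, $1/p+1/q=1$, and write $\widehat f_k$ for the Fourier coefficients of $f\in L^1(\mathbb T)$. Let $H^p=\{f\in L^p(\mathbb T):\widehat f_k=0\text{ for }k<0\}$ and $\overline{H^p}=\{f\in L^p(\mathbb T):\widehat f_k=0\text{ for }k>0\}$, let $P:\sum_{k\in\mathbb Z}\widehat f_kt^k\mapsto\sum_{k\ge0}\widehat f_kt^k$ be the bounded projection of $L^p$ onto $H^p$, let $Q=I-P$, and for $g\in L^\infty(\mathbb T)$ let $T(g):H^p\to H^p$, $\varphi\mapsto P(g\varphi)$, be the Toeplitz operator. Fix $\beta\in\mathbb C$ with $|\beta|>1$ and put $$\alpha(t)=\frac{t-\beta}{\overline\beta t-1},\qquad \lambda=i\sqrt{|\beta|^2-1},\qquad \alpha_-(t)=\frac{\lambda t}{\overline\beta t-1},\qquad \chi(t)=\frac{t}{\alpha_-(t)},\qquad (J_\alpha\varphi)(t)=\chi(t)^{-1}\varphi(\alpha(t)).$$ A factorization $g=g_-t^{k}g_+$ with $k\in\mathbb Z$, $g_+\in H^q$, $g_+^{-1}\in H^p$, $g_-\in\overline{H^p}$,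 $g_-^{-1}\in\overline{H^q}$, $g_-(\infty)=1$ is called a Wiener–Hopf factorization of $g$ in $H^p$ if the operator $g_+^{-1}Pg_-^{-1}I$, defined on the polynomials in $t$, extends to a bounded operator on $H^p$. Let $g\in L^\infty(\mathbb T)$ be $\alpha$-matching, that is, $g(t)\,g(\alpha(t))=1$ for almost all $t\in\mathbb T$, and let $T(g):H^p\to H^p$ be Fredholm with $n:=\operatorname{ind}T(g)=\dim\ker T(g)-\dim\operatorname{coker}T(g)>0$. Let $g=g_-t^{-n}g_+$ be the Wiener–Hopf factorization of $g$ in $H^p$ and let $$\sigma=\boldsymbol\sigma_\alpha(g)=\Big(\frac{\lambda}{\overline\beta}\Big)^{n}g_+^{-1}\Big(\frac1{\overline\beta}\Big)$$ be the $\alpha$-signature of $g$, where $g_+^{-1}$ is evaluated through its analytic extension to the unit disc. On $\ker T(g)$ consider the operators $\mathbf P_\alpha(g)=J_\alpha QgP$ and $\mathbf P_\alpha^{\pm}(g)=\frac12\big(I\pm\mathbf P_\alpha(g)\big)$. **Theorem.** For each choice of the sign $\pm$: 1. If $n=2m$ with $m\in\mathbb N$, then $$\{g_+^{-1}(\chi^{m-k-1}\pm\sigma\chi^{m+k}):k=0,1,\dots,m-1\}$$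 is a basis of $\operatorname{im}\mathbf P_\alpha^{\pm}(g)$, and $\dim\operatorname{im}\mathbf P_\alpha^{\pm}(g)=m$. 2. If $n=2m+1$ with $m\in\{0,1,2,\dots\}$, then $$\{g_+^{-1}(\chi^{m+k}\pm\sigma\chi^{m-k}):k=0,1,\dots,m\}\setminus\{0\}$$ is a basis of $\operatorname{im}\mathbf P_\alpha^{\pm}(g)$, and $\dim\operatorname{im}\mathbf P_\alpha^{\pm}(g)=m+\frac{1\pm\sigma}{2}$. -/

import Mathlib

open MeasureTheory Complex AddCircle
open scoped ENNReal Real ComplexConjugate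

noncomputable section

namespace ToeplitzHankel

/-! ### The unit circle, the shift and the weight -/

instance two_pi_pos_fact : Fact (0 < 2 * π) := ⟨Real.two_pi_pos⟩

/-- The unit circle, parametrized by the angle: the point `x` stands for `t = exp (i x)`. -/
abbrev Torus : Type := AddCircle (2 * π)

/-- Normalized Lebesgue measure on the circle. -/
abbrev torusMeasure : Measure Torus := haarAddCircle

/-- The complex coordinate `t = exp (i x)` of a point of the circle. -/
def coord (x : Torus) : ℂ := (homeomorphCircle' x : ℂ)

/-- The linear fractional map `α(z) = (z - β) / (conj β * z - 1)`. -/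
def alphaMap (β z : ℂ) : ℂ := (z - β) / (conj β * z - 1)

/-- The action of `α` on the circle (through the angle of `α(t)`; see `coord_shift`). -/
def shift (β : ℂ) (x : Torus) : Torus := ((arg (alphaMap β (coord x)) : ℝ) : Torus)

/-- `λ = i √(|β|² - 1)`. -/
def lam (β : ℂ) : ℂ := I * (Real.sqrt (‖β‖ ^ 2 - 1) : ℝ)

/-- `α₋(t) = λ t / (conj β * t - 1)`. -/
def alphaMinus (β t : ℂ) : ℂ := lam β * t / (conj β * t - 1)

/-- `χ(t) = t / α₋(t)`, as a function on the circle. -/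
def chi (β : ℂ) (x : Torus) : ℂ := coord x / alphaMinus β (coord x)

lemma norm_coord (x : Torus) : ‖coord x‖ = 1 := Circle.norm_coe _

lemma coord_coe (θ : ℝ) : coord (θ : Torus) = exp (θ * I) := by
  simp [coord, homeomorphCircle'_apply_mk, Circle.coe_exp]

lemma continuous_coord : Continuous coord :=
  continuous_subtype_val.comp homeomorphCircle'.continuous

lemma denom_ne_zero {β : ℂ} (hβ : 1 < ‖β‖) {z : ℂ} (hz : ‖z‖ = 1) : conj β * z - 1 ≠ 0 := by
  intro h
  have h1 : conj β * z = 1 := sub_eq_zero.mp h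
  have h2 : ‖conj β * z‖ = 1 := by rw [h1]; simp
  rw [norm_mul, hz, mul_one, RCLike.norm_conj] at h2
  linarith

lemma denom_eq {β z : ℂ} (hz : ‖z‖ = 1) : conj β * z - 1 = - (z * conj (z - β)) := by
  have : z * conj z = 1 := by rw [mul_conj, normSq_eq_norm_sq, hz]; simp
  rw [map_sub]
  linear_combination this

lemma norm_alphaMap {β : ℂ} (hβ : 1 < ‖β‖) {z : ℂ} (hz : ‖z‖ = 1) : ‖alphaMap β z‖ = 1 := by
  have h := denom_ne_zero hβ hz
  have h2 : ‖conj β * z - 1‖ = ‖z - β‖ := by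
    rw [denom_eq hz, norm_neg, norm_mul, hz, one_mul, RCLike.norm_conj]
  rw [alphaMap, norm_div, h2, div_self]
  rw [← h2]; simpa using h

/-- `shift β` is indeed the map `t ↦ α(t)` of the circle. -/
lemma coord_shift {β : ℂ} (hβ : 1 < ‖β‖) (x : Torus) :
    coord (shift β x) = alphaMap β (coord x) := by
  have h := norm_mul_exp_arg_mul_I (alphaMap β (coord x))
  rw [norm_alphaMap hβ (norm_coord x)] at h
  rw [shift, coord_coe]
  simpa using h

lemma coord_injective : Function.Injective coord := fun _ _ h =>
  homeomorphCircle'.injective (Subtype.ext h)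

lemma measurable_shift (β : ℂ) : Measurable (shift β) := by
  have h1 : Measurable coord := continuous_coord.measurable
  have h2 : Measurable fun r : ℝ => (r : Torus) := AddCircle.measurable_mk'
  unfold shift alphaMap
  exact h2.comp (measurable_arg.comp ((h1.sub_const β).div ((h1.const_mul _).sub_const 1)))

/-! A real lift of the shift, used to compare Lebesgue measure with its image under `α`. -/

/-- `w(θ) = 1 - exp (i θ) / β`. -/
def liftAux (β : ℂ) (θ : ℝ) : ℂ := 1 - exp (θ * I) / β

/-- A real lift of the shift: `α(exp (i θ)) = exp (i φ(θ))`. -/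
def shiftLift (β : ℂ) (θ : ℝ) : ℝ := arg (β / conj β) + π - θ + 2 * (log (liftAux β θ)).im

/-- The derivative of the lift. -/
def shiftLiftDeriv (β : ℂ) (θ : ℝ) : ℝ :=
  -1 + 2 * ((- (exp (θ * I) * I / β)) / liftAux β θ).im

lemma norm_exp_div {β : ℂ} (θ : ℝ) : ‖exp (θ * I) / β‖ = ‖β‖⁻¹ := by
  rw [norm_div, norm_exp_ofReal_mul_I, one_div]

lemma re_liftAux_pos {β : ℂ} (hβ : 1 < ‖β‖) (θ : ℝ) : 0 < (liftAux β θ).re := by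
  have h1 : (exp (θ * I) / β).re ≤ ‖β‖⁻¹ := (re_le_norm _).trans (norm_exp_div θ).le
  have h2 : ‖β‖⁻¹ < 1 := inv_lt_one_of_one_lt₀ hβ
  simp only [liftAux, sub_re, one_re]
  linarith

lemma hasDerivAt_shiftLift {β : ℂ} (hβ : 1 < ‖β‖) (θ : ℝ) :
    HasDerivAt (shiftLift β) (shiftLiftDeriv β θ) θ := by
  have h1 : HasDerivAt (fun θ : ℝ => exp (θ * I)) (exp (θ * I) * I) θ := by
    have : HasDerivAt (fun θ : ℝ => (θ : ℂ) * I) (1 * I) θ :=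
      (HasDerivAt.ofReal_comp (hasDerivAt_id θ)).mul_const I
    simpa using this.cexp
  have h2 : HasDerivAt (liftAux β) (- (exp (θ * I) * I / β)) θ := by
    simpa [liftAux] using! (h1.div_const β).const_sub 1
  have h3 := h2.clog_real (Or.inl (re_liftAux_pos hβ θ))
  have h4 := imCLM.hasFDerivAt.comp_hasDerivAt θ h3
  have h5 := ((hasDerivAt_id θ).const_sub (arg (β / conj β) + π)).add (h4.const_mul 2)
  simpa [shiftLift, shiftLiftDeriv] using! h5

lemma shiftLiftDeriv_le {β : ℂ} (hβ : 1 < ‖β‖) (θ : ℝ) :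
    shiftLiftDeriv β θ ≤ - ((‖β‖ - 1) / (‖β‖ + 1)) := by
  set u : ℂ := exp (θ * I) / β with hu
  have hnu : ‖u‖ = ‖β‖⁻¹ := norm_exp_div θ
  have hw : liftAux β θ = 1 - u := rfl
  have hre : 0 < (1 - u).re := hw ▸ re_liftAux_pos hβ θ
  have hne : (1 - u) ≠ 0 := by intro h; rw [h] at hre; simp at hre
  have e1 : shiftLiftDeriv β θ = - ((1 - ‖u‖ ^ 2) / ‖1 - u‖ ^ 2) := by
    have : -(exp (θ * I) * I / β) = - (u * I) := by rw [hu]; ring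
    rw [shiftLiftDeriv, this, hw, ← normSq_eq_norm_sq, ← normSq_eq_norm_sq]
    have hns : normSq (1 - u) ≠ 0 := by simpa using hne
    rw [div_im]
    field_simp
    simp [normSq_apply]
    ring
  have hb : 0 < ‖β‖ := by linarith
  have hn1 : ‖1 - u‖ ≤ 1 + ‖u‖ := by simpa using norm_sub_le (1 : ℂ) u
  have hpos : 0 < ‖1 - u‖ := norm_pos_iff.mpr hne
  have hu1 : ‖u‖ < 1 := by rw [hnu]; exact inv_lt_one_of_one_lt₀ hβ
  have hu0 : 0 ≤ ‖u‖ := norm_nonneg u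
  have e2 : (‖β‖ - 1) / (‖β‖ + 1) = (1 - ‖u‖ ^ 2) / (1 + ‖u‖) ^ 2 := by
    rw [hnu]; field_simp; ring
  rw [e1, e2, neg_le_neg_iff]
  have : 0 ≤ 1 - ‖u‖ ^ 2 := by nlinarith
  gcongr

lemma shift_coe {β : ℂ} (hβ : 1 < ‖β‖) (θ : ℝ) :
    shift β (θ : Torus) = (shiftLift β θ : Torus) := by
  apply coord_injective
  rw [coord_shift hβ, coord_coe, coord_coe]
  have hβ0 : β ≠ 0 := by rintro rfl; simp at hβ; linarith
  have hcβ : conj β ≠ 0 := by simpa using hβ0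
  have hw0 : liftAux β θ ≠ 0 := by
    intro h; have := re_liftAux_pos hβ θ; rw [h] at this; simp at this
  have hcw0 : conj (liftAux β θ) ≠ 0 := by simpa using hw0
  have hz : ‖exp (θ * I)‖ = 1 := norm_exp_ofReal_mul_I θ
  have hE : exp ((arg (β / conj β) : ℝ) * I) = β / conj β := by
    have := norm_mul_exp_arg_mul_I (β / conj β)
    rwa [norm_div, RCLike.norm_conj, div_self (by simpa using hβ0), ofReal_one, one_mul] at this
  have hL : exp ((2 * (log (liftAux β θ)).im : ℝ) * I) = liftAux β θ / conj (liftAux β θ) := by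
    have h1 : ((2 * (log (liftAux β θ)).im : ℝ) : ℂ) * I
        = log (liftAux β θ) - conj (log (liftAux β θ)) := by
      rw [sub_conj]
    rw [h1, exp_sub, exp_log hw0, exp_conj, exp_log hw0]
  have hS : ((shiftLift β θ : ℝ) : ℂ) * I = (arg (β / conj β) : ℝ) * I + π * I - θ * I
      + (2 * (log (liftAux β θ)).im : ℝ) * I := by
    rw [shiftLift]; push_cast; ring
  rw [hS, exp_add, exp_sub, exp_add, hE, hL, exp_pi_mul_I, alphaMap, denom_eq hz]
  have h2 : exp (θ * I) - β = - β * liftAux β θ := by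
    rw [liftAux]; field_simp; ring
  rw [h2]
  have he : exp (θ * I) ≠ 0 := exp_ne_zero _
  rw [map_mul, map_neg]
  field_simp

lemma shiftLift_sub_two_pi (β : ℂ) (θ : ℝ) : shiftLift β (θ + 2 * π) = shiftLift β θ - 2 * π := by
  have : liftAux β (θ + 2 * π) = liftAux β θ := by
    have h : ((θ + 2 * π : ℝ) : ℂ) * I = θ * I + 2 * π * I := by push_cast; ring
    rw [liftAux, liftAux, h, exp_periodic]
  rw [shiftLift, shiftLift, this]
  ring

lemma strictAnti_shiftLift {β : ℂ} (hβ : 1 < ‖β‖) : StrictAnti (shiftLift β) := by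
  apply strictAnti_of_deriv_neg
  intro θ
  rw [(hasDerivAt_shiftLift hβ θ).deriv]
  refine (shiftLiftDeriv_le hβ θ).trans_lt ?_
  have : 0 < (‖β‖ - 1) / (‖β‖ + 1) := div_pos (by linarith) (by linarith)
  linarith

/-- The image of Lebesgue measure under `α` is at most a constant times Lebesgue measure. -/
lemma map_shift_le {β : ℂ} (hβ : 1 < ‖β‖) :
    torusMeasure.map (shift β) ≤
      (ENNReal.ofReal ((‖β‖ - 1) / (‖β‖ + 1)))⁻¹ • torusMeasure := by
  set c : ℝ := (‖β‖ - 1) / (‖β‖ + 1) with hc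
  have hc0 : 0 < c := div_pos (by linarith) (by linarith)
  have key : ∀ s : Set Torus, MeasurableSet s →
      volume (shift β ⁻¹' s) ≤ (ENNReal.ofReal c)⁻¹ * volume s := by
    intro s hs
    have hpre : MeasurableSet (shift β ⁻¹' s) := measurable_shift β hs
    set F : Torus → ℝ≥0∞ := s.indicator 1 with hF
    have h1 : volume (shift β ⁻¹' s) = ∫⁻ θ in Set.Ico (0:ℝ) (2 * π), F (shiftLift β θ : Torus) := by
      rw [← lintegral_indicator_one hpre, ← AddCircle.lintegral_preimage (2 * π) 0, zero_add,
        ← restrict_Ico_eq_restrict_Ioc]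
      refine lintegral_congr fun θ => ?_
      rw [← shift_coe hβ]
      rfl
    have h2 : ENNReal.ofReal c * volume (shift β ⁻¹' s)
        ≤ ∫⁻ y in shiftLift β '' Set.Ico (0:ℝ) (2 * π), F (y : Torus) := by
      rw [lintegral_image_eq_lintegral_abs_deriv_mul measurableSet_Ico
        (fun θ _ => (hasDerivAt_shiftLift hβ θ).hasDerivWithinAt)
        (strictAnti_shiftLift hβ).injective.injOn, h1, ← lintegral_const_mul' _ _ (by simp)]
      refine lintegral_mono fun θ => ?_
      gcongr
      have := shiftLiftDeriv_le hβ θ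
      rw [abs_of_nonpos (by linarith)]
      linarith
    have h3 : shiftLift β '' Set.Ico (0:ℝ) (2 * π) ⊆
        Set.Ioc (shiftLift β 0 - 2 * π) (shiftLift β 0 - 2 * π + 2 * π) := by
      rintro _ ⟨θ, ⟨h0, h2π⟩, rfl⟩
      have e := shiftLift_sub_two_pi β 0
      rw [zero_add] at e
      refine ⟨e ▸ strictAnti_shiftLift hβ h2π, ?_⟩
      rw [sub_add_cancel]
      exact (strictAnti_shiftLift hβ).antitone h0
    have h4 : ENNReal.ofReal c * volume (shift β ⁻¹' s) ≤ volume s := by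
      refine h2.trans ((lintegral_mono_set h3).trans ?_)
      rw [AddCircle.lintegral_preimage (2 * π) _ F, hF, lintegral_indicator_one hs]
    rw [← ENNReal.div_eq_inv_mul]
    refine (ENNReal.le_div_iff_mul_le (by simp [hc0]) (by simp)).mpr ?_
    exact (mul_comm _ _).trans_le h4
  refine Measure.le_iff.mpr fun s hs => ?_
  rw [Measure.map_apply (measurable_shift β) hs, Measure.smul_apply, smul_eq_mul]
  have hk := key s hs
  rw [volume_eq_smul_haarAddCircle, Measure.smul_apply, Measure.smul_apply, smul_eq_mul,
    smul_eq_mul, mul_left_comm] at hk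
  exact (ENNReal.mul_le_mul_iff_right (by simp [Real.pi_pos]) ENNReal.ofReal_ne_top).mp hk

lemma quasiMeasurePreserving_shift {β : ℂ} (hβ : 1 < ‖β‖) :
    Measure.QuasiMeasurePreserving (shift β) torusMeasure torusMeasure :=
  ⟨measurable_shift β,
    (Measure.absolutelyContinuous_of_le_smul (map_shift_le hβ))⟩

lemma continuous_chi_inv {β : ℂ} (hβ : 1 < ‖β‖) : Continuous fun x => (chi β x)⁻¹ := by
  have h : ∀ x, (chi β x)⁻¹ = lam β / (conj β * coord x - 1) := by
    intro x
    have h0 : coord x ≠ 0 := by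
      intro h; have := norm_coord x; rw [h] at this; simp at this
    rw [chi, inv_div, alphaMinus]
    field_simp
  simp_rw [h]
  have := continuous_coord
  exact continuous_const.div (by fun_prop) fun x => denom_ne_zero hβ (norm_coord x)

/-! ### The operators `J_α`, `P`, `Q`, multiplication, Hardy spaces -/

lemma memLp_shiftOp {β : ℂ} (hβ : 1 < ‖β‖) {p : ℝ≥0∞} {f : Torus → ℂ}
    (hf : MemLp f p torusMeasure) :
    MemLp (fun x => (chi β x)⁻¹ * f (shift β x)) p torusMeasure := by
  have hK : (ENNReal.ofReal ((‖β‖ - 1) / (‖β‖ + 1)))⁻¹ ≠ ∞ := by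
    have : 0 < (‖β‖ - 1) / (‖β‖ + 1) := div_pos (by linarith) (by linarith)
    simpa using this
  have h1 : MemLp (f ∘ shift β) p torusMeasure :=
    (hf.of_measure_le_smul hK (map_shift_le hβ)).comp_of_map (measurable_shift β).aemeasurable
  obtain ⟨C, hC⟩ := isCompact_univ.exists_bound_of_continuousOn (continuous_chi_inv hβ).continuousOn
  have h2 : MemLp (fun x => (chi β x)⁻¹) ∞ torusMeasure :=
    memLp_top_of_bound (continuous_chi_inv hβ).aestronglyMeasurable C
      (Filter.Eventually.of_forall fun x => hC x trivial)
  exact h1.mul (p := ∞) (q := p) (r := p) h2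

/-- The weighted shift operator `(J_α φ)(t) = χ(t)⁻¹ φ(α(t)) = t⁻¹ α₋(t) φ(α(t))` on `L^p`. -/
def weightedShift {β : ℂ} (hβ : 1 < ‖β‖) (p : ℝ≥0∞) :
    Lp ℂ p torusMeasure →ₗ[ℂ] Lp ℂ p torusMeasure where
  toFun f := (memLp_shiftOp hβ (Lp.memLp f)).toLp _
  map_add' f g := by
    rw [← MemLp.toLp_add]
    apply MemLp.toLp_congr
    filter_upwards [(quasiMeasurePreserving_shift hβ).ae (Lp.coeFn_add f g)] with x hx
    simp only [Pi.add_apply] at hx ⊢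
    rw [hx, mul_add]
  map_smul' c f := by
    rw [RingHom.id_apply, ← MemLp.toLp_const_smul]
    apply MemLp.toLp_congr
    filter_upwards [(quasiMeasurePreserving_shift hβ).ae (Lp.coeFn_smul c f)] with x hx
    simp only [Pi.smul_apply, smul_eq_mul] at hx ⊢
    rw [hx, mul_left_comm]

/-- `P` acts on Fourier series by `∑_{n ∈ ℤ} f̂ₙ tⁿ ↦ ∑_{n ≥ 0} f̂ₙ tⁿ`. -/
def IsAnalyticProjection (p : ℝ≥0∞) [Fact (1 ≤ p)]
    (P : Lp ℂ p torusMeasure →L[ℂ] Lp ℂ p torusMeasure) : Prop :=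
  ∀ (f : Lp ℂ p torusMeasure) (n : ℤ),
    fourierCoeff (P f) n = if 0 ≤ n then fourierCoeff f n else 0

open Classical in
/-- The bounded projection `P` of `L^p` onto `H^p`. For `1 < p < ∞` the operator described by
`IsAnalyticProjection` exists by the theorem of M. Riesz, and it is unique because an `L^p`
function is determined by its Fourier coefficients; the default value is used for no such `p`. -/
def analyticProjection (p : ℝ≥0∞) [Fact (1 ≤ p)] :
    Lp ℂ p torusMeasure →L[ℂ] Lp ℂ p torusMeasure :=
  if h : ∃ P, IsAnalyticProjection p P then h.choose else 0

/-- `Q = I - P`. -/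
def coanalyticProjection (p : ℝ≥0∞) [Fact (1 ≤ p)] :
    Lp ℂ p torusMeasure →L[ℂ] Lp ℂ p torusMeasure :=
  ContinuousLinearMap.id ℂ _ - analyticProjection p

/-- The operator of multiplication by `g ∈ L^∞` on `L^p`. -/
def mulOp (p : ℝ≥0∞) [Fact (1 ≤ p)] (g : Lp ℂ ∞ torusMeasure) :
    Lp ℂ p torusMeasure →L[ℂ] Lp ℂ p torusMeasure :=
  (ContinuousLinearMap.mul ℂ ℂ).holderL torusMeasure ∞ p p g

lemma integrable_Lp {p : ℝ≥0∞} [hp : Fact (1 ≤ p)] (f : Lp ℂ p torusMeasure) :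
    Integrable f torusMeasure := (Lp.memLp f).integrable hp.out

/-- The Hardy space `H^p = {f ∈ L^p : f̂ₙ = 0 for n < 0}`. -/
def hardy (p : ℝ≥0∞) [Fact (1 ≤ p)] : Submodule ℂ (Lp ℂ p torusMeasure) where
  carrier := {f | ∀ n : ℤ, n < 0 → fourierCoeff f n = 0}
  zero_mem' n _ := by
    rw [fourierCoeff_congr_ae (Lp.coeFn_zero ℂ p torusMeasure)]
    simp [fourierCoeff]
  add_mem' {f g} hf hg n hn := by
    rw [fourierCoeff_congr_ae (Lp.coeFn_add f g),
      fourierCoeff.add (integrable_Lp f) (integrable_Lp g), Pi.add_apply, hf n hn, hg n hn,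
      add_zero]
  smul_mem' c f hf n hn := by
    rw [fourierCoeff_congr_ae (Lp.coeFn_smul c f), fourierCoeff.const_smul, hf n hn, smul_zero]

lemma analyticProjection_mem (p : ℝ≥0∞) [Fact (1 ≤ p)] (f : Lp ℂ p torusMeasure) :
    analyticProjection p f ∈ hardy p := by
  classical
  unfold analyticProjection
  split_ifs with h
  · intro n hn
    rw [h.choose_spec f n, if_neg (not_le.mpr hn)]
  · simp

/-- The Toeplitz operator `T(g) : H^p → H^p`, `φ ↦ P (g φ)`. -/
def toeplitz (p : ℝ≥0∞) [Fact (1 ≤ p)] (g : Lp ℂ ∞ torusMeasure) : hardy p →L[ℂ] hardy p :=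
  (analyticProjection p ∘L mulOp p g ∘L (hardy p).subtypeL).codRestrict (hardy p)
    fun _ => analyticProjection_mem p _

/-- `g` is an `α`-matching function: `g g_α = 1`, where `g_α(t) = g(α(t))`. -/
def IsMatching (β : ℂ) (g : Lp ℂ ∞ torusMeasure) : Prop :=
  ∀ᵐ x ∂torusMeasure, g x * g (shift β x) = 1

/-- The operator `P_α(g) = J_α Q g P` restricted to `ker T(g)`. -/
def kernelFlip {β : ℂ} (hβ : 1 < ‖β‖) (p : ℝ≥0∞) [Fact (1 ≤ p)] (g : Lp ℂ ∞ torusMeasure) :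
    (toeplitz p g).ker →ₗ[ℂ] Lp ℂ p torusMeasure :=
  weightedShift hβ p ∘ₗ
    (coanalyticProjection p ∘L mulOp p g ∘L analyticProjection p).toLinearMap ∘ₗ
    (hardy p).subtype ∘ₗ (toeplitz p g).ker.subtype

/-- The operators `P_α^±(g) = (1/2)(I ± P_α(g))` on `ker T(g)`; `ε = 1` and `ε = -1` give the
upper and the lower sign. -/
def kernelProj {β : ℂ} (hβ : 1 < ‖β‖) (p : ℝ≥0∞) [Fact (1 ≤ p)] (g : Lp ℂ ∞ torusMeasure)
    (ε : ℂ) : (toeplitz p g).ker →ₗ[ℂ] Lp ℂ p torusMeasure :=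
  (1 / 2 : ℂ) • ((hardy p).subtype ∘ₗ (toeplitz p g).ker.subtype + ε • kernelFlip hβ p g)

/-! ### Wiener-Hopf factorization and the signature -/

/-- The function `f` belongs to `H^p`. -/
def MemHardy (p : ℝ≥0∞) (f : Torus → ℂ) : Prop :=
  MemLp f p torusMeasure ∧ ∀ n : ℤ, n < 0 → fourierCoeff f n = 0

/-- The function `f` belongs to `conj H^p`, that is, `f ∈ L^p` and `f̂ₙ = 0` for `n > 0`. -/
def MemHardyConj (p : ℝ≥0∞) (f : Torus → ℂ) : Prop :=
  MemLp f p torusMeasure ∧ ∀ n : ℤ, 0 < n → fourierCoeff f n = 0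

/-- `g = g₋ t^k g₊` is a Wiener-Hopf factorization of `g` in `H^p`, where `1/p + 1/q = 1`. -/
structure IsWienerHopf (p q : ℝ≥0∞) [Fact (1 ≤ p)] (g : Torus → ℂ) (gm : Torus → ℂ) (k : ℤ)
    (gp : Torus → ℂ) : Prop where
  factorization : ∀ᵐ x ∂torusMeasure, g x = gm x * coord x ^ k * gp x
  minus_ne_zero : ∀ᵐ x ∂torusMeasure, gm x ≠ 0
  plus_ne_zero : ∀ᵐ x ∂torusMeasure, gp x ≠ 0
  plus_mem : MemHardy q gp
  plus_inv_mem : MemHardy p fun x => (gp x)⁻¹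
  minus_mem : MemHardyConj p gm
  minus_inv_mem : MemHardyConj q fun x => (gm x)⁻¹
  /-- `g₋(∞) = 1`; the value at infinity is the zeroth Fourier coefficient. -/
  minus_infty : fourierCoeff gm 0 = 1
  /-- The operator `g₊⁻¹ P g₋⁻¹ I`, defined on the polynomials in `t`, extends to a bounded
  operator on `H^p`. The spectrum of `g₋⁻¹ t^j` lies in `(-∞, j]`, so that `P (g₋⁻¹ t^j)` is the
  polynomial below. -/
  bounded_extension : ∃ A : hardy p →L[ℂ] hardy p, ∀ (j : ℕ) (f : hardy p),
    ((f : Lp ℂ p torusMeasure) : Torus → ℂ) =ᵐ[torusMeasure] (fun x => coord x ^ j) →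
    ((A f : Lp ℂ p torusMeasure) : Torus → ℂ) =ᵐ[torusMeasure] fun x => (gp x)⁻¹ *
      ∑ i ∈ Finset.range (j + 1), fourierCoeff (fun y => (gm y)⁻¹ * coord y ^ j) i * coord x ^ i

/-- The value at `z`, `|z| < 1`, of the analytic extension of `f ∈ H^p` to the unit disc. -/
def discValue (f : Torus → ℂ) (z : ℂ) : ℂ := ∑' k : ℕ, fourierCoeff f (k : ℤ) * z ^ k

/-- The `α`-factorization signature `(λ / conj β)^n g₊⁻¹(1 / conj β)`. -/
def signature (β : ℂ) (n : ℕ) (gp : Torus → ℂ) : ℂ :=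
  (lam β / conj β) ^ n * discValue (fun x => (gp x)⁻¹) (1 / conj β)

/-- The system `{g₊⁻¹ (χ^{m-k-1} + ε σ χ^{m+k}) : k = 0, …, m-1}` for the index `n = 2m`. -/
def evenSystem (β : ℂ) (p : ℝ≥0∞) (gp : Torus → ℂ) (m : ℕ) (ε : ℂ) :
    Set (Lp ℂ p torusMeasure) :=
  {h | ∃ k < m, h =ᵐ[torusMeasure] fun x =>
    (gp x)⁻¹ * (chi β x ^ (m - k - 1) + ε * signature β (2 * m) gp * chi β x ^ (m + k))}

/-- The system `{g₊⁻¹ (χ^{m+k} + ε σ χ^{m-k}) : k = 0, …, m} \ {0}` for the index `n = 2m+1`. -/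
def oddSystem (β : ℂ) (p : ℝ≥0∞) (gp : Torus → ℂ) (m : ℕ) (ε : ℂ) :
    Set (Lp ℂ p torusMeasure) :=
  {h | ∃ k ≤ m, h =ᵐ[torusMeasure] fun x =>
    (gp x)⁻¹ * (chi β x ^ (m + k) + ε * signature β (2 * m + 1) gp * chi β x ^ (m - k))} \ {0}

/-- The set `B` of vectors is a basis of the subspace `V`. -/
def IsBasisOf {E : Type*} [AddCommGroup E] [Module ℂ E] (B : Set E) (V : Submodule ℂ E) : Prop :=
  LinearIndepOn ℂ id B ∧ Submodule.span ℂ B = V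

end ToeplitzHankel

end

noncomputable section

namespace ToeplitzHankel

/-! ### Fourier coefficients of integrable functions -/

/-! The map α interchanges the disc with its exterior, takes ∞ to 1/conj β, and satisfies χ(α(t)) =
1/χ(t). Rewrite the factorization with χ in place of t: g = G χ^{-n} g₊, where G = α₋^{-n} g₋ is
still coanalytic.

The kernel of T(g) consists of the functions g₊⁻¹ r with r a polynomial of degree < n. This is a
Liouville argument: for f in the kernel, f g₊ is analytic, and it equals tⁿ times the coanalytic
function (g f) g₋⁻¹, which vanishes at ∞. Since χ is affine in t, the functions e_j = g₊⁻¹ χ^j, j <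
n, span the kernel (`chiSystem_mem_ker`, `mem_span_chiSystem`), and they are independent
(`linearIndependent_chiSystem`).

Matching says that (G∘α) g₊ and G (g₊∘α) are reciprocal. The first is analytic and its inverse's
counterpart (g₊∘α)⁻¹ G⁻¹ is coanalytic, so both are one constant; its value at ∞ is σ, and applying
α once more gives σ² = 1 (`shifted_minus_mul_plus`). Hence G∘α = σ g₊⁻¹, and J_α(g e_j) = σ
e_{n-1-j}: the flip reverses the basis up to σ (`kernelFlip_chiSystem`). The image of P_α^± is then
spanned by the e_j ± σ e_{n-1-j}, and a basis is selected by elementary linear algebra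
(`isBasisOf_even`, `isBasisOf_odd`).

All facts about products and compositions in Hardy spaces are checked on monomials and extended by
continuity through the analytic projection. That this projection exists is extracted from
Fredholmness. -/

lemma coord_ne_zero (x : Torus) : coord x ≠ 0 := by
  intro h
  have := norm_coord x
  simp [h] at this

lemma coord_eq_fourier_one (x : Torus) : coord x = fourier 1 x := by
  induction x using QuotientAddGroup.induction_on with
  | H θ =>
    rw [fourier_coe_apply]
    refine (coord_coe θ).trans ?_
    congr 1
    push_cast
    have : (π : ℂ) ≠ 0 := by exact_mod_cast Real.pi_ne_zero
    field_simp

lemma coord_zpow (x : Torus) (k : ℤ) : coord x ^ k = fourier k x := by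
  have hnat : ∀ k : ℕ, coord x ^ k = fourier (k : ℤ) x := by
    intro k
    induction k with
    | zero => rw [pow_zero, Nat.cast_zero, fourier_zero]
    | succ k ih => rw [pow_succ, ih, Nat.cast_succ, fourier_add, coord_eq_fourier_one]
  obtain ⟨k, rfl | rfl⟩ := k.eq_nat_or_neg
  · exact_mod_cast hnat k
  · rw [zpow_neg, zpow_natCast, hnat, fourier_neg]
    refine inv_eq_of_mul_eq_one_left ?_
    rw [← fourier_neg, ← fourier_add, neg_add_cancel, fourier_zero]

lemma norm_coord_zpow (x : Torus) (k : ℤ) : ‖coord x ^ k‖ = 1 := by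
  rw [norm_zpow, norm_coord, one_zpow]

lemma continuous_coord_zpow (k : ℤ) : Continuous fun x => coord x ^ k :=
  continuous_coord.zpow₀ k fun x => Or.inl (coord_ne_zero x)

lemma fourierCoeff_eq_integral (f : Torus → ℂ) (n : ℤ) :
    fourierCoeff f n = ∫ x, coord x ^ (-n) * f x ∂torusMeasure := by
  simp_rw [coord_zpow, ← smul_eq_mul]
  rfl

lemma fourierCoeff_coord_mul (f : Torus → ℂ) (j n : ℤ) :
    fourierCoeff (fun x => coord x ^ j * f x) n = fourierCoeff f (n - j) := by
  simp_rw [fourierCoeff_eq_integral, ← mul_assoc, ← zpow_add₀ (coord_ne_zero _)]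
  congr! 4
  ring

lemma fourierCoeff_conj (f : Torus → ℂ) (n : ℤ) :
    fourierCoeff (fun x => conj (f x)) n = conj (fourierCoeff f (-n)) := by
  simp_rw [fourierCoeff_eq_integral]
  rw [← integral_conj]
  congr 1
  funext x
  rw [map_mul, map_zpow₀, ← inv_eq_conj (norm_coord x), inv_zpow', neg_neg]

lemma integrable_bdd_mul {φ f : Torus → ℂ} (hφ : Continuous φ) (hf : Integrable f torusMeasure) :
    Integrable (fun x => φ x * f x) torusMeasure := by
  obtain ⟨C, hC⟩ := isCompact_univ.exists_bound_of_continuousOn hφ.continuousOn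
  exact hf.bdd_mul hφ.aestronglyMeasurable (Filter.Eventually.of_forall fun x => hC x trivial)

lemma memLp_continuous_mul {φ f : Torus → ℂ} {p : ℝ≥0∞} (hφ : Continuous φ)
    (hf : MemLp f p torusMeasure) : MemLp (fun x => φ x * f x) p torusMeasure := by
  obtain ⟨C, hC⟩ := isCompact_univ.exists_bound_of_continuousOn hφ.continuousOn
  have h : MemLp φ ∞ torusMeasure :=
    memLp_top_of_bound hφ.aestronglyMeasurable C (Filter.Eventually.of_forall fun x => hC x trivial)
  exact hf.mul (p := ∞) (q := p) (r := p) h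

lemma fourierCoeff_fun_add {f g : Torus → ℂ} (hf : Integrable f torusMeasure)
    (hg : Integrable g torusMeasure) (n : ℤ) :
    fourierCoeff (fun x => f x + g x) n = fourierCoeff f n + fourierCoeff g n :=
  congrFun (fourierCoeff.add hf hg) n

lemma fourierCoeff_fun_sub {f g : Torus → ℂ} (hf : Integrable f torusMeasure)
    (hg : Integrable g torusMeasure) (n : ℤ) :
    fourierCoeff (fun x => f x - g x) n = fourierCoeff f n - fourierCoeff g n := by
  have h := fourierCoeff_fun_add hf (hg.const_mul (-1)) n
  rw [fourierCoeff.const_mul] at h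
  simpa [sub_eq_add_neg] using h

lemma norm_fourierCoeff_le (f : Torus → ℂ) (n : ℤ) :
    ‖fourierCoeff f n‖ ≤ ∫ x, ‖f x‖ ∂torusMeasure := by
  rw [fourierCoeff_eq_integral]
  refine (norm_integral_le_integral_norm _).trans_eq ?_
  simp_rw [norm_mul, norm_coord_zpow, one_mul]

lemma fourierCoeff_coord_zpow (j n : ℤ) :
    fourierCoeff (fun x => coord x ^ j) n = if n = j then 1 else 0 := by
  have h := fourierCoeff_fourier (T := 2 * π) j
  have e : (fun x : Torus => coord x ^ j) = fourier j := funext fun x => coord_zpow x j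
  rw [e, h, Pi.single_apply]

/-- The functional φ ↦ ∫ φ f is bounded on C(𝕋) and kills the trigonometric polynomials, which are
dense in the uniform norm. -/
lemma integral_continuous_mul_eq_zero {f : Torus → ℂ} (hf : Integrable f torusMeasure)
    (h : ∀ n, fourierCoeff f n = 0) (φ : C(Torus, ℂ)) : ∫ x, φ x * f x ∂torusMeasure = 0 := by
  have hint : ∀ φ : C(Torus, ℂ), Integrable (fun x => φ x * f x) torusMeasure :=
    fun φ => integrable_bdd_mul φ.continuous hf
  let A : C(Torus, ℂ) →ₗ[ℂ] ℂ :=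
    { toFun := fun φ => ∫ x, φ x * f x ∂torusMeasure
      map_add' := fun φ ψ => by
        rw [← integral_add (hint φ) (hint ψ)]
        simp [add_mul]
      map_smul' := fun c φ => by
        rw [RingHom.id_apply, smul_eq_mul, ← integral_const_mul]
        simp [mul_assoc] }
  have hA : ∀ φ, ‖A φ‖ ≤ (∫ x, ‖f x‖ ∂torusMeasure) * ‖φ‖ := by
    intro φ
    refine (norm_integral_le_integral_norm _).trans ?_
    rw [← integral_mul_const]
    refine integral_mono (hint φ).norm (hf.norm.mul_const _) fun x => ?_
    simp only [norm_mul]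
    rw [mul_comm]
    gcongr
    exact φ.norm_coe_le_norm x
  have hdense : Dense (Submodule.span ℂ (Set.range (@fourier (2 * π))) : Set C(Torus, ℂ)) := by
    rw [Submodule.dense_iff_topologicalClosure_eq_top]
    exact span_fourier_closure_eq_top
  have hzero : A.mkContinuous _ hA = 0 := by
    refine ContinuousLinearMap.ext_on hdense ?_
    rintro _ ⟨n, rfl⟩
    have := h (-n)
    rw [fourierCoeff_eq_integral, neg_neg] at this
    simp_rw [coord_zpow] at this
    exact this
  exact DFunLike.congr_fun hzero φ

lemma ae_eq_zero_of_fourierCoeff_eq_zero {f : Torus → ℂ} (hf : Integrable f torusMeasure)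
    (h : ∀ n, fourierCoeff f n = 0) : f =ᵐ[torusMeasure] 0 := by
  refine ae_eq_zero_of_forall_setIntegral_isClosed_eq_zero hf fun s hs => ?_
  -- The indicator of a closed set is a bounded pointwise limit of continuous functions, so
  -- dominated convergence carries the vanishing over to integrals over closed sets.
  have hlim : Filter.Tendsto (fun n : ℕ => ∫ x, ((hs.apprSeq n x : ℝ) : ℂ) * f x ∂torusMeasure)
      Filter.atTop (nhds (∫ x, s.indicator f x ∂torusMeasure)) := by
    refine tendsto_integral_of_dominated_convergence (fun x => ‖f x‖) (fun n => ?_) hf.norm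
      (fun n => Filter.Eventually.of_forall fun x => ?_)
      (Filter.Eventually.of_forall fun x => ?_)
    · refine AEStronglyMeasurable.mul ?_ hf.aestronglyMeasurable
      have : Continuous (hs.apprSeq n) := (hs.apprSeq n).continuous
      exact Continuous.aestronglyMeasurable (by fun_prop)
    · have h1 : (hs.apprSeq n x : ℝ) ≤ 1 := by
        exact_mod_cast HasOuterApproxClosed.apprSeq_apply_le_one hs n x
      rw [norm_mul, norm_real, Real.norm_of_nonneg (NNReal.coe_nonneg _)]
      exact mul_le_of_le_one_left (norm_nonneg _) h1
    · have h1 := tendsto_pi_nhds.mp (HasOuterApproxClosed.tendsto_apprSeq hs) x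
      have h2 : Filter.Tendsto (fun n => ((hs.apprSeq n x : ℝ) : ℂ)) Filter.atTop
          (nhds (((s.indicator (fun _ => (1 : NNReal)) x : NNReal) : ℝ) : ℂ)) :=
        (continuous_ofReal.comp NNReal.continuous_coe).continuousAt.tendsto.comp h1
      have h3 := h2.mul_const (f x)
      convert! h3 using 2
      by_cases hx : x ∈ s <;> simp [hx]
  have hz : ∀ n : ℕ, ∫ x, ((hs.apprSeq n x : ℝ) : ℂ) * f x ∂torusMeasure = 0 := fun n =>
    integral_continuous_mul_eq_zero hf h
      ⟨fun x => ((hs.apprSeq n x : ℝ) : ℂ), by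
        have : Continuous (hs.apprSeq n) := (hs.apprSeq n).continuous
        fun_prop⟩
  simp_rw [hz] at hlim
  rw [← integral_indicator hs.measurableSet]
  exact (tendsto_nhds_unique hlim tendsto_const_nhds)

lemma ae_eq_of_fourierCoeff_eq {f g : Torus → ℂ} (hf : Integrable f torusMeasure)
    (hg : Integrable g torusMeasure) (h : ∀ n, fourierCoeff f n = fourierCoeff g n) :
    f =ᵐ[torusMeasure] g := by
  have := ae_eq_zero_of_fourierCoeff_eq_zero (hf.sub hg) fun n => by
    rw [Pi.sub_def, fourierCoeff_fun_sub hf hg, h, sub_self]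
  filter_upwards [this] with x hx
  exact sub_eq_zero.mp hx

/-! ### The analytic projection and functionals determined by their values on monomials -/

section Projection

variable {p : ℝ≥0∞} [hp1 : Fact (1 ≤ p)]

lemma Lp_ext_fourierCoeff {f g : Lp ℂ p torusMeasure}
    (h : ∀ n, fourierCoeff f n = fourierCoeff g n) : f = g :=
  Lp.ext (ae_eq_of_fourierCoeff_eq (integrable_Lp f) (integrable_Lp g) h)

lemma coeFn_fourierLp_coord (j : ℤ) :
    (fourierLp p j : Lp ℂ p torusMeasure) =ᵐ[torusMeasure] fun x => coord x ^ j := by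
  filter_upwards [coeFn_fourierLp p j] with x hx
  rw [hx, coord_zpow]

lemma fourierCoeff_fourierLp (j n : ℤ) :
    fourierCoeff (fourierLp p j : Lp ℂ p torusMeasure) n = if n = j then 1 else 0 := by
  rw [fourierCoeff_congr_ae (coeFn_fourierLp_coord j), fourierCoeff_coord_zpow]

omit hp1 in
lemma fourierCoeff_Lp_zero (n : ℤ) : fourierCoeff (0 : Lp ℂ p torusMeasure) n = 0 := by
  rw [fourierCoeff_congr_ae (Lp.coeFn_zero ℂ p torusMeasure)]
  simp [fourierCoeff]

variable {P : Lp ℂ p torusMeasure →L[ℂ] Lp ℂ p torusMeasure}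

lemma IsAnalyticProjection.apply_eq_self (hP : IsAnalyticProjection p P)
    {f : Lp ℂ p torusMeasure} (hf : f ∈ hardy p) : P f = f := by
  refine Lp_ext_fourierCoeff fun n => ?_
  rw [hP]
  split_ifs with hn
  · rfl
  · exact (hf n (not_le.mp hn)).symm

lemma IsAnalyticProjection.apply_eq_zero_iff (hP : IsAnalyticProjection p P)
    (f : Lp ℂ p torusMeasure) : P f = 0 ↔ ∀ n : ℤ, 0 ≤ n → fourierCoeff f n = 0 := by
  constructor
  · intro h n hn
    have := hP f n
    rwa [h, fourierCoeff_Lp_zero, if_pos hn, eq_comm] at this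
  · intro h
    refine Lp_ext_fourierCoeff fun n => ?_
    rw [hP, fourierCoeff_Lp_zero]
    split_ifs with hn
    · exact h n hn
    · rfl

lemma fourierLp_mem_hardy {j : ℤ} (hj : 0 ≤ j) :
    (fourierLp p j : Lp ℂ p torusMeasure) ∈ hardy p := by
  intro n hn
  rw [fourierCoeff_fourierLp, if_neg (by omega)]

lemma IsAnalyticProjection.apply_fourierLp (hP : IsAnalyticProjection p P) (j : ℤ) :
    P (fourierLp p j) = if 0 ≤ j then fourierLp p j else 0 := by
  split_ifs with hj
  · exact hP.apply_eq_self (fourierLp_mem_hardy hj)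
  · rw [hP.apply_eq_zero_iff]
    intro n hn
    rw [fourierCoeff_fourierLp, if_neg (by omega)]

lemma clm_ext_fourierLp (hp : p ≠ ∞) {A B : Lp ℂ p torusMeasure →L[ℂ] ℂ}
    (h : ∀ j : ℤ, A (fourierLp p j) = B (fourierLp p j)) : A = B := by
  have hdense : Dense (Submodule.span ℂ (Set.range (@fourierLp (2 * π) _ p _)) :
      Set (Lp ℂ p torusMeasure)) := by
    rw [Submodule.dense_iff_topologicalClosure_eq_top]
    exact span_fourierLp_closure_eq_top hp
  refine ContinuousLinearMap.ext_on hdense ?_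
  rintro _ ⟨n, rfl⟩
  exact h n

/-- A ∘ P kills every monomial, hence vanishes by density, and P is the identity on H^p. This avoids
a separate density theorem for polynomials in H^p. -/
lemma IsAnalyticProjection.clm_eq_zero_of_mem_hardy (hP : IsAnalyticProjection p P) (hp : p ≠ ∞)
    {A : Lp ℂ p torusMeasure →L[ℂ] ℂ} (hA : ∀ j : ℤ, 0 ≤ j → A (fourierLp p j) = 0)
    {f : Lp ℂ p torusMeasure} (hf : ∀ n : ℤ, n < 0 → fourierCoeff f n = 0) : A f = 0 := by
  have h : A ∘L P = 0 := clm_ext_fourierLp hp fun j => by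
    rw [ContinuousLinearMap.comp_apply, hP.apply_fourierLp]
    split_ifs with hj
    · simpa using hA j hj
    · simp
  have := DFunLike.congr_fun h f
  rwa [ContinuousLinearMap.comp_apply, hP.apply_eq_self hf] at this

/-- A and A ∘ P agree on monomials, hence everywhere; P reduces a coanalytic function to its
constant term, which A kills. -/
lemma IsAnalyticProjection.clm_eq_zero_of_conj_hardy (hP : IsAnalyticProjection p P) (hp : p ≠ ∞)
    {A : Lp ℂ p torusMeasure →L[ℂ] ℂ} (hA : ∀ j : ℤ, j ≤ 0 → A (fourierLp p j) = 0)
    {f : Lp ℂ p torusMeasure} (hf : ∀ n : ℤ, 0 < n → fourierCoeff f n = 0) : A f = 0 := by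
  have h : A = A ∘L P := clm_ext_fourierLp hp fun j => by
    rw [ContinuousLinearMap.comp_apply, hP.apply_fourierLp]
    split_ifs with hj
    · rfl
    · rw [map_zero, hA j (by omega)]
  have hPf : P f = fourierCoeff f 0 • fourierLp p 0 := by
    refine Lp_ext_fourierCoeff fun n => ?_
    rw [hP, fourierCoeff_congr_ae (Lp.coeFn_smul _ _), fourierCoeff.const_smul,
      fourierCoeff_fourierLp]
    rcases lt_trichotomy n 0 with hn | rfl | hn
    · simp [hn.ne, not_le.mpr hn]
    · simp
    · simp [hf n hn, hn.ne']
  have := DFunLike.congr_fun h f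
  rw [this, ContinuousLinearMap.comp_apply, hPf, map_smul, hA 0 le_rfl, smul_zero]

end Projection

/-- A bounded linear functional on `L^p`, given on functions. -/
structure IsBoundedFunctional (p : ℝ≥0∞) (F : (Torus → ℂ) → ℂ) : Prop where
  congr : ∀ f g, f =ᵐ[torusMeasure] g → F f = F g
  add : ∀ f g, MemLp f p torusMeasure → MemLp g p torusMeasure → F (f + g) = F f + F g
  smul : ∀ (c : ℂ) f, F (c • f) = c * F f
  bound : ∃ C : ℝ, ∀ f, MemLp f p torusMeasure → ‖F f‖ ≤ C * (eLpNorm f p torusMeasure).toReal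

namespace IsBoundedFunctional

variable {p : ℝ≥0∞} {F G : (Torus → ℂ) → ℂ}

lemma sub_const_mul (hF : IsBoundedFunctional p F) (hG : IsBoundedFunctional p G) (c : ℂ) :
    IsBoundedFunctional p fun f => F f - c * G f where
  congr f g h := by rw [hF.congr f g h, hG.congr f g h]
  add f g hf hg := by rw [hF.add f g hf hg, hG.add f g hf hg]; ring
  smul a f := by rw [hF.smul, hG.smul]; ring
  bound := by
    obtain ⟨C, hC⟩ := hF.bound
    obtain ⟨D, hD⟩ := hG.bound
    refine ⟨C + ‖c‖ * D, fun f hf => (norm_sub_le _ _).trans ?_⟩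
    rw [norm_mul, add_mul, mul_assoc]
    gcongr
    · exact hC f hf
    · exact hD f hf

variable [hp1 : Fact (1 ≤ p)]

lemma exists_clm (hF : IsBoundedFunctional p F) :
    ∃ A : Lp ℂ p torusMeasure →L[ℂ] ℂ, ∀ f, A f = F f := by
  obtain ⟨C, hC⟩ := hF.bound
  let A : Lp ℂ p torusMeasure →ₗ[ℂ] ℂ :=
    { toFun := fun f => F f
      map_add' := fun f g => by
        rw [hF.congr _ _ (Lp.coeFn_add f g), hF.add _ _ (Lp.memLp f) (Lp.memLp g)]
      map_smul' := fun c f => by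
        rw [hF.congr _ _ (Lp.coeFn_smul c f), hF.smul]
        rfl }
  exact ⟨A.mkContinuous C fun f => hC f (Lp.memLp f), fun f => rfl⟩

variable {P : Lp ℂ p torusMeasure →L[ℂ] Lp ℂ p torusMeasure}

/-- The working principle for Hardy functions: an identity between bounded functionals need only be
verified on t^j, j ≥ 0. -/
lemma eq_zero_of_memHardy (hF : IsBoundedFunctional p F) (hP : IsAnalyticProjection p P)
    (hp : p ≠ ∞) (hz : ∀ j : ℤ, 0 ≤ j → F (fun x => coord x ^ j) = 0) {f : Torus → ℂ}
    (hf : MemHardy p f) : F f = 0 := by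
  obtain ⟨A, hA⟩ := hF.exists_clm
  rw [← hF.congr _ _ hf.1.coeFn_toLp, ← hA]
  refine hP.clm_eq_zero_of_mem_hardy hp (fun j hj => ?_) fun n hn => ?_
  · rw [hA, hF.congr _ _ (coeFn_fourierLp_coord j), hz j hj]
  · rw [fourierCoeff_congr_ae hf.1.coeFn_toLp, hf.2 n hn]

lemma eq_zero_of_memHardyConj (hF : IsBoundedFunctional p F) (hP : IsAnalyticProjection p P)
    (hp : p ≠ ∞) (hz : ∀ j : ℤ, j ≤ 0 → F (fun x => coord x ^ j) = 0) {f : Torus → ℂ}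
    (hf : MemHardyConj p f) : F f = 0 := by
  obtain ⟨A, hA⟩ := hF.exists_clm
  rw [← hF.congr _ _ hf.1.coeFn_toLp, ← hA]
  refine hP.clm_eq_zero_of_conj_hardy hp (fun j hj => ?_) fun n hn => ?_
  · rw [hA, hF.congr _ _ (coeFn_fourierLp_coord j), hz j hj]
  · rw [fourierCoeff_congr_ae hf.1.coeFn_toLp, hf.2 n hn]

end IsBoundedFunctional

lemma integral_norm_le_eLpNorm {p : ℝ≥0∞} [hp1 : Fact (1 ≤ p)] {f : Torus → ℂ}
    (hf : MemLp f p torusMeasure) :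
    ∫ x, ‖f x‖ ∂torusMeasure ≤ (eLpNorm f p torusMeasure).toReal := by
  rw [integral_norm_eq_lintegral_enorm hf.1, ← eLpNorm_one_eq_lintegral_enorm]
  exact ENNReal.toReal_mono hf.2.ne (eLpNorm_le_eLpNorm_of_exponent_le hp1.out hf.1)

/-! ### Products of functions from Hardy spaces -/

section Products

variable {p q : ℝ≥0∞} [hp1 : Fact (1 ≤ p)] [hpq : p.HolderConjugate q]

omit hp1 in
lemma integrable_mul_of_memLp {f h : Torus → ℂ} (hf : MemLp f p torusMeasure)
    (hh : MemLp h q torusMeasure) : Integrable (fun x => f x * h x) torusMeasure :=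
  hf.integrable_mul hh

omit hp1 in
lemma integral_norm_mul_le {f h : Torus → ℂ} (hf : MemLp f p torusMeasure)
    (hh : MemLp h q torusMeasure) : ∫ x, ‖f x * h x‖ ∂torusMeasure ≤
      (eLpNorm h q torusMeasure).toReal * (eLpNorm f p torusMeasure).toReal := by
  have e : (fun x => f x * h x) = h • f := funext fun x => mul_comm _ _
  rw [integral_norm_eq_lintegral_enorm (integrable_mul_of_memLp hf hh).1,
    ← eLpNorm_one_eq_lintegral_enorm, e, ← ENNReal.toReal_mul]
  have := hpq.symm
  exact ENNReal.toReal_mono (ENNReal.mul_ne_top hh.2.ne hf.2.ne)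
    (eLpNorm_smul_le_mul_eLpNorm (p := q) (q := p) (r := 1) hf.1 hh.1)

omit hp1 in
lemma isBoundedFunctional_fourierCoeff_mul {h : Torus → ℂ} (hh : MemLp h q torusMeasure) (n : ℤ) :
    IsBoundedFunctional p fun f => fourierCoeff (fun x => f x * h x) n where
  congr f g e := by
    refine congrFun (fourierCoeff_congr_ae ?_) n
    filter_upwards [e] with x hx
    rw [hx]
  add f g hf hg := by
    rw [← fourierCoeff_fun_add (integrable_mul_of_memLp hf hh) (integrable_mul_of_memLp hg hh)]
    simp [add_mul]
  smul c f := by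
    rw [← fourierCoeff.const_mul]
    simp [mul_assoc]
  bound := by
    exact ⟨(eLpNorm h q torusMeasure).toReal, fun f hf =>
      (norm_fourierCoeff_le _ n).trans (integral_norm_mul_le hf hh)⟩

variable {P : Lp ℂ p torusMeasure →L[ℂ] Lp ℂ p torusMeasure}

/-- For f = t^j with j ≥ 0 the product only moves the spectrum of h upwards; Hölder's inequality
makes the coefficient a bounded functional of f. -/
lemma fourierCoeff_mul_of_memHardy (hP : IsAnalyticProjection p P) (hp : p ≠ ∞)
    {f h : Torus → ℂ} (hf : MemHardy p f) (hh : MemHardy q h) {n : ℤ} (hn : n < 0) :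
    fourierCoeff (fun x => f x * h x) n = 0 := by
  refine (isBoundedFunctional_fourierCoeff_mul hh.1 n).eq_zero_of_memHardy hP hp (fun j hj => ?_) hf
  rw [fourierCoeff_coord_mul, hh.2 _ (by omega)]

lemma fourierCoeff_mul_of_memHardyConj (hP : IsAnalyticProjection p P) (hp : p ≠ ∞)
    {f h : Torus → ℂ} (hf : MemHardyConj p f) (hh : MemHardyConj q h) {n : ℤ} (hn : 0 < n) :
    fourierCoeff (fun x => f x * h x) n = 0 := by
  refine (isBoundedFunctional_fourierCoeff_mul hh.1 n).eq_zero_of_memHardyConj hP hp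
    (fun j hj => ?_) hf
  rw [fourierCoeff_coord_mul, hh.2 _ (by omega)]

lemma fourierCoeff_zero_mul_of_memHardyConj (hP : IsAnalyticProjection p P) (hp : p ≠ ∞)
    {f h : Torus → ℂ} (hf : MemHardyConj p f) (hh : MemHardyConj q h) :
    fourierCoeff (fun x => f x * h x) 0 = fourierCoeff f 0 * fourierCoeff h 0 := by
  -- The functional f ↦ (f h)^₀ - ĥ₀ f̂₀; the second coefficient is the case of the constant
  -- multiplier 1.
  have hF := (isBoundedFunctional_fourierCoeff_mul (p := p) hh.1 0).sub_const_mul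
    (isBoundedFunctional_fourierCoeff_mul (p := p) (q := q) (memLp_const 1) 0) (fourierCoeff h 0)
  have := hF.eq_zero_of_memHardyConj hP hp (fun j hj => ?_) hf
  · simp only [mul_one] at this
    rw [sub_eq_zero.mp this, mul_comm]
  · simp only [mul_one]
    rw [fourierCoeff_coord_mul, fourierCoeff_coord_zpow]
    rcases hj.lt_or_eq with hj | rfl
    · rw [hh.2 _ (by omega), if_neg (by omega), mul_zero, sub_zero]
    · simp

end Products

/-! ### Multipliers of the spaces `conj H^p` -/

/-- The continuous function `φ` is a multiplier of the functions whose Fourier coefficients with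
positive index vanish, with the value `a` at infinity. -/
def IsConjMultiplier (φ : Torus → ℂ) (a : ℂ) : Prop :=
  Continuous φ ∧ ∀ f : Torus → ℂ, Integrable f torusMeasure →
    (∀ n : ℤ, 0 < n → fourierCoeff f n = 0) →
    (∀ n : ℤ, 0 < n → fourierCoeff (fun x => φ x * f x) n = 0) ∧
      fourierCoeff (fun x => φ x * f x) 0 = a * fourierCoeff f 0

namespace IsConjMultiplier

variable {φ ψ : Torus → ℂ} {a b : ℂ}

lemma const (a : ℂ) : IsConjMultiplier (fun _ => a) a := by
  refine ⟨continuous_const, fun f _ hf => ⟨fun n hn => ?_, ?_⟩⟩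
  · rw [fourierCoeff.const_mul, hf n hn, mul_zero]
  · rw [fourierCoeff.const_mul]

lemma mul (hφ : IsConjMultiplier φ a) (hψ : IsConjMultiplier ψ b) :
    IsConjMultiplier (fun x => φ x * ψ x) (a * b) := by
  refine ⟨hφ.1.mul hψ.1, fun f hi hf => ?_⟩
  obtain ⟨h1, h2⟩ := hψ.2 f hi hf
  obtain ⟨h3, h4⟩ := hφ.2 _ (integrable_bdd_mul hψ.1 hi) h1
  simp only [mul_assoc]
  exact ⟨h3, by rw [h4, h2]⟩

lemma sub (hφ : IsConjMultiplier φ a) (hψ : IsConjMultiplier ψ b) :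
    IsConjMultiplier (fun x => φ x - ψ x) (a - b) := by
  refine ⟨hφ.1.sub hψ.1, fun f hi hf => ?_⟩
  obtain ⟨h1, h2⟩ := hψ.2 f hi hf
  obtain ⟨h3, h4⟩ := hφ.2 f hi hf
  simp only [sub_mul]
  have h := fourierCoeff_fun_sub (integrable_bdd_mul hφ.1 hi) (integrable_bdd_mul hψ.1 hi)
  refine ⟨fun n hn => ?_, ?_⟩
  · rw [h, h1 n hn, h3 n hn, sub_zero]
  · rw [h, h2, h4]

lemma pow (hφ : IsConjMultiplier φ a) (j : ℕ) : IsConjMultiplier (fun x => φ x ^ j) (a ^ j) := by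
  induction j with
  | zero => simpa using const 1
  | succ j ih => simpa only [pow_succ] using ih.mul hφ

lemma coord_inv : IsConjMultiplier (fun x => (coord x)⁻¹) 0 := by
  have h : ∀ f : Torus → ℂ, ∀ n : ℤ,
      fourierCoeff (fun x => (coord x)⁻¹ * f x) n = fourierCoeff f (n + 1) := by
    intro f n
    simpa using fourierCoeff_coord_mul f (-1) n
  refine ⟨continuous_coord.inv₀ coord_ne_zero, fun f _ hf => ⟨fun n hn => ?_, ?_⟩⟩
  · rw [h, hf _ (by omega)]
  · rw [h, hf _ (by omega), zero_mul]

lemma memHardyConj {p : ℝ≥0∞} [hp1 : Fact (1 ≤ p)] (hφ : IsConjMultiplier φ a) {f : Torus → ℂ}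
    (hf : MemHardyConj p f) : MemHardyConj p fun x => φ x * f x :=
  ⟨memLp_continuous_mul hφ.1 hf.1, (hφ.2 f (hf.1.integrable hp1.out) hf.2).1⟩

lemma fourierCoeff_zero {p : ℝ≥0∞} [hp1 : Fact (1 ≤ p)] (hφ : IsConjMultiplier φ a) {f : Torus → ℂ}
    (hf : MemHardyConj p f) : fourierCoeff (fun x => φ x * f x) 0 = a * fourierCoeff f 0 :=
  (hφ.2 f (hf.1.integrable hp1.out) hf.2).2

lemma fourierCoeff_self (hφ : IsConjMultiplier φ a) :
    (∀ n : ℤ, 0 < n → fourierCoeff φ n = 0) ∧ fourierCoeff φ 0 = a := by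
  have h : ∀ n : ℤ, fourierCoeff (fun _ : Torus => (1 : ℂ)) n = if n = 0 then 1 else 0 := by
    intro n
    simpa using fourierCoeff_coord_zpow 0 n
  have := hφ.2 (fun _ => 1) (integrable_const 1) fun n hn => by rw [h, if_neg hn.ne']
  simpa [h] using this

end IsConjMultiplier

/-! ### Identities for α, α₋, χ and their behaviour at infinity -/

section Alpha

variable {β : ℂ}

lemma conj_ne_zero_of_one_lt_norm (hβ : 1 < ‖β‖) : conj β ≠ 0 := by
  intro h
  rw [map_eq_zero] at h
  simp only [h, norm_zero] at hβ
  linarith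

lemma lam_sq (hβ : 1 < ‖β‖) : lam β ^ 2 = 1 - conj β * β := by
  have h0 : 0 ≤ ‖β‖ ^ 2 - 1 := by nlinarith
  rw [lam, mul_pow, I_sq, ← ofReal_pow, Real.sq_sqrt h0, mul_comm (conj β), mul_conj,
    normSq_eq_norm_sq]
  push_cast
  ring

lemma lam_ne_zero (hβ : 1 < ‖β‖) : lam β ≠ 0 := by
  have h0 : 0 < ‖β‖ ^ 2 - 1 := by nlinarith
  have := (Real.sqrt_pos.mpr h0).ne'
  rw [lam]
  exact mul_ne_zero I_ne_zero (by exact_mod_cast this)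

lemma chi_eq (hβ : 1 < ‖β‖) (x : Torus) : chi β x = (conj β * coord x - 1) / lam β := by
  have h1 := coord_ne_zero x
  have h2 := lam_ne_zero hβ
  have h3 := denom_ne_zero hβ (norm_coord x)
  rw [chi, alphaMinus]
  field_simp

lemma chi_ne_zero (hβ : 1 < ‖β‖) (x : Torus) : chi β x ≠ 0 := by
  rw [chi_eq hβ]
  exact div_ne_zero (denom_ne_zero hβ (norm_coord x)) (lam_ne_zero hβ)

lemma continuous_chi (hβ : 1 < ‖β‖) : Continuous (chi β) := by
  rw [funext (chi_eq hβ)]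
  have := continuous_coord
  fun_prop

/-- The numerator of χ∘α is conj β (t - β) - (conj β t - 1) = 1 - |β|², which is λ²; this is why λ
is chosen so. -/
lemma chi_shift (hβ : 1 < ‖β‖) (x : Torus) : chi β (shift β x) = (chi β x)⁻¹ := by
  have h2 := lam_ne_zero hβ
  have h3 := denom_ne_zero hβ (norm_coord x)
  rw [chi_eq hβ, chi_eq hβ, coord_shift hβ, alphaMap]
  field_simp
  rw [lam_sq hβ]
  ring

lemma shift_shift (hβ : 1 < ‖β‖) (x : Torus) : shift β (shift β x) = x := by
  apply coord_injective
  have h : chi β (shift β (shift β x)) = chi β x := by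
    rw [chi_shift hβ, chi_shift hβ, inv_inv]
  rw [chi_eq hβ, chi_eq hβ, div_left_inj' (lam_ne_zero hβ), sub_left_inj] at h
  exact mul_left_cancel₀ (conj_ne_zero_of_one_lt_norm hβ) h

lemma alphaMinus_coord (β : ℂ) (x : Torus) :
    alphaMinus β (coord x) = coord x * (chi β x)⁻¹ := by
  have h1 := coord_ne_zero x
  rw [chi]
  field_simp

/-- A nonzero coefficient would make the later ones grow like |β|^k, while all are bounded by the L¹
norm. -/
lemma fourierCoeff_eq_zero_of_recurrence (hβ : 1 < ‖β‖) {h : Torus → ℂ}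
    (hrec : ∀ n : ℤ, 0 < n → fourierCoeff h (n + 1) = conj β * fourierCoeff h n) {n : ℤ}
    (hn : 0 < n) : fourierCoeff h n = 0 := by
  by_contra hne
  have hk : ∀ k : ℕ, fourierCoeff h (n + k) = conj β ^ k * fourierCoeff h n := by
    intro k
    induction k with
    | zero => simp
    | succ k ih =>
      rw [Nat.cast_succ, ← add_assoc, hrec _ (by omega), ih, pow_succ]
      ring
  obtain ⟨k, hk'⟩ := pow_unbounded_of_one_lt
    ((∫ x, ‖h x‖ ∂torusMeasure) / ‖fourierCoeff h n‖) hβ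
  rw [div_lt_iff₀ (norm_pos_iff.mpr hne)] at hk'
  have := norm_fourierCoeff_le h (n + k)
  rw [hk, norm_mul, norm_pow, RCLike.norm_conj] at this
  linarith

lemma isConjMultiplier_alphaMinus (hβ : 1 < ‖β‖) :
    IsConjMultiplier (fun x => alphaMinus β (coord x)) (lam β / conj β) := by
  have hcβ := conj_ne_zero_of_one_lt_norm hβ
  have hcont : Continuous fun x => alphaMinus β (coord x) := by
    rw [funext (alphaMinus_coord β)]
    exact continuous_coord.mul (continuous_chi_inv hβ)
  refine ⟨hcont, fun f hi hf => ?_⟩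
  have hint := integrable_bdd_mul hcont hi
  -- Coefficients of the identity (conj β - t⁻¹) α₋ f = λ f. For n > 0 it is a homogeneous
  -- recurrence; n = 0 yields the value at infinity.
  have key : ∀ n : ℤ, conj β * fourierCoeff (fun x => alphaMinus β (coord x) * f x) n
      - fourierCoeff (fun x => alphaMinus β (coord x) * f x) (n + 1) = lam β * fourierCoeff f n := by
    intro n
    have h1 := fourierCoeff_coord_mul (fun x => alphaMinus β (coord x) * f x) (-1) n
    rw [sub_neg_eq_add] at h1
    rw [← h1, ← fourierCoeff.const_mul, ← fourierCoeff.const_mul, ← fourierCoeff_fun_sub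
      (hint.const_mul _) (integrable_bdd_mul (continuous_coord_zpow _) hint)]
    congr 1
    funext x
    have h1 := coord_ne_zero x
    have h3 := denom_ne_zero hβ (norm_coord x)
    rw [alphaMinus, zpow_neg_one]
    field_simp
  have hz : ∀ n : ℤ, 0 < n → fourierCoeff (fun x => alphaMinus β (coord x) * f x) n = 0 := by
    intro n hn
    refine fourierCoeff_eq_zero_of_recurrence hβ (fun n hn => ?_) hn
    have := key n
    rw [hf n hn, mul_zero] at this
    exact (sub_eq_zero.mp this).symm
  refine ⟨hz, ?_⟩
  have := key 0
  rw [hz (0 + 1) (by omega), sub_zero] at this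
  rw [div_mul_eq_mul_div, eq_div_iff hcβ, ← this, mul_comm]

lemma isConjMultiplier_alphaMinus_inv (hβ : 1 < ‖β‖) :
    IsConjMultiplier (fun x => (alphaMinus β (coord x))⁻¹) (conj β / lam β) := by
  have h := (IsConjMultiplier.const (1 / lam β)).mul
    ((IsConjMultiplier.const (conj β)).sub IsConjMultiplier.coord_inv)
  convert h using 1
  · funext x
    have h1 := coord_ne_zero x
    have h2 := lam_ne_zero hβ
    rw [alphaMinus]
    field_simp
  · ring

lemma isConjMultiplier_chi_inv (hβ : 1 < ‖β‖) : IsConjMultiplier (fun x => (chi β x)⁻¹) 0 := by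
  have h := IsConjMultiplier.coord_inv.mul (isConjMultiplier_alphaMinus hβ)
  convert h using 1
  · funext x
    rw [alphaMinus_coord β, inv_mul_cancel_left₀ (coord_ne_zero x)]
  · ring

/-- α = α₋ (1 - β t⁻¹)/λ is a product of coanalytic multipliers, and α(∞) = 1/conj β. -/
lemma isConjMultiplier_coord_shift (hβ : 1 < ‖β‖) :
    IsConjMultiplier (fun x => coord (shift β x)) (1 / conj β) := by
  have h := (isConjMultiplier_alphaMinus hβ).mul ((IsConjMultiplier.const (1 / lam β)).mul
    ((IsConjMultiplier.const 1).sub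
      ((IsConjMultiplier.const β).mul IsConjMultiplier.coord_inv)))
  have h2 := lam_ne_zero hβ
  convert h using 1
  · funext x
    have h1 := coord_ne_zero x
    have h3 := denom_ne_zero hβ (norm_coord x)
    rw [coord_shift hβ, alphaMap, alphaMinus]
    field_simp
  · field_simp
    ring

lemma fourierCoeff_coord_shift_zpow (hβ : 1 < ‖β‖) {j : ℤ} (hj : 0 ≤ j) :
    (∀ n : ℤ, 0 < n → fourierCoeff (fun x => coord (shift β x) ^ j) n = 0) ∧
      fourierCoeff (fun x => coord (shift β x) ^ j) 0 = (1 / conj β) ^ j := by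
  lift j to ℕ using hj
  simpa only [zpow_natCast] using ((isConjMultiplier_coord_shift hβ).pow j).fourierCoeff_self

lemma fourierCoeff_coord_shift_zpow_of_nonpos (hβ : 1 < ‖β‖) {j n : ℤ} (hj : j ≤ 0) (hn : n < 0) :
    fourierCoeff (fun x => coord (shift β x) ^ j) n = 0 := by
  -- Since |α| = 1 on the circle, negative powers of α are conjugates of positive ones.
  have h : (fun x => coord (shift β x) ^ j) = fun x => conj (coord (shift β x) ^ (-j)) := by
    funext x
    rw [map_zpow₀, ← inv_eq_conj (norm_coord _), inv_zpow', neg_neg]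
  rw [h, fourierCoeff_conj, (fourierCoeff_coord_shift_zpow hβ (by omega)).1 _ (by omega), map_zero]

/-! ### Composition with the shift -/

lemma shift_const_ne_top (hβ : 1 < ‖β‖) :
    (ENNReal.ofReal ((‖β‖ - 1) / (‖β‖ + 1)))⁻¹ ≠ ∞ := by
  have : 0 < (‖β‖ - 1) / (‖β‖ + 1) := div_pos (by linarith) (by linarith)
  simpa using this

lemma memLp_comp_shift (hβ : 1 < ‖β‖) {p : ℝ≥0∞} {f : Torus → ℂ} (hf : MemLp f p torusMeasure) :
    MemLp (fun x => f (shift β x)) p torusMeasure :=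
  (hf.of_measure_le_smul (shift_const_ne_top hβ) (map_shift_le hβ)).comp_of_map
    (measurable_shift β).aemeasurable

lemma integral_norm_comp_shift_le (hβ : 1 < ‖β‖) {f : Torus → ℂ} (hf : Integrable f torusMeasure) :
    ∫ x, ‖f (shift β x)‖ ∂torusMeasure ≤
      (ENNReal.ofReal ((‖β‖ - 1) / (‖β‖ + 1)))⁻¹.toReal * ∫ x, ‖f x‖ ∂torusMeasure := by
  have h1 : AEStronglyMeasurable (fun x => ‖f x‖) (torusMeasure.map (shift β)) :=
    hf.norm.1.mono_ac (quasiMeasurePreserving_shift hβ).absolutelyContinuous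
  rw [← integral_map (measurable_shift β).aemeasurable h1]
  refine (integral_mono_measure (map_shift_le hβ)
    (Filter.Eventually.of_forall fun x => norm_nonneg _)
    (hf.norm.smul_measure (shift_const_ne_top hβ))).trans_eq ?_
  rw [integral_smul_measure, smul_eq_mul]

variable {p : ℝ≥0∞} [hp1 : Fact (1 ≤ p)]

lemma isBoundedFunctional_fourierCoeff_comp_shift (hβ : 1 < ‖β‖) (n : ℤ) :
    IsBoundedFunctional p fun f => fourierCoeff (fun x => f (shift β x)) n where
  congr f g e :=
    congrFun (fourierCoeff_congr_ae ((quasiMeasurePreserving_shift hβ).ae_eq_comp e)) n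
  add f g hf hg := fourierCoeff_fun_add ((memLp_comp_shift hβ hf).integrable hp1.out)
    ((memLp_comp_shift hβ hg).integrable hp1.out) n
  smul c f := fourierCoeff.const_mul _ c n
  bound := by
    refine ⟨(ENNReal.ofReal ((‖β‖ - 1) / (‖β‖ + 1)))⁻¹.toReal, fun f hf =>
      (norm_fourierCoeff_le _ n).trans
        ((integral_norm_comp_shift_le hβ (hf.integrable hp1.out)).trans ?_)⟩
    gcongr
    exact integral_norm_le_eLpNorm hf

lemma hasSum_discValue_bound {z : ℂ} (hz : ‖z‖ < 1) (f : Torus → ℂ) :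
    HasSum (fun k : ℕ => (∫ x, ‖f x‖ ∂torusMeasure) * ‖z‖ ^ k)
      ((∫ x, ‖f x‖ ∂torusMeasure) * (1 - ‖z‖)⁻¹) :=
  (hasSum_geometric_of_lt_one (norm_nonneg z) hz).mul_left _

lemma norm_discValue_term_le (f : Torus → ℂ) (z : ℂ) (k : ℕ) :
    ‖fourierCoeff f (k : ℤ) * z ^ k‖ ≤ (∫ x, ‖f x‖ ∂torusMeasure) * ‖z‖ ^ k := by
  rw [norm_mul, norm_pow]
  gcongr
  exact norm_fourierCoeff_le f k

lemma isBoundedFunctional_discValue {z : ℂ} (hz : ‖z‖ < 1) :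
    IsBoundedFunctional p fun f => discValue f z where
  congr f g e := by rw [discValue, discValue, fourierCoeff_congr_ae e]
  add f g hf hg := by
    have hs : ∀ f : Torus → ℂ, Summable fun k : ℕ => fourierCoeff f (k : ℤ) * z ^ k := fun f =>
      Summable.of_norm_bounded (hasSum_discValue_bound hz f).summable (norm_discValue_term_le f z)
    rw [discValue, discValue, discValue, ← (hs f).tsum_add (hs g),
      fourierCoeff.add (hf.integrable hp1.out) (hg.integrable hp1.out)]
    simp [add_mul]
  smul c f := by
    simp only [discValue, fourierCoeff.const_smul, smul_eq_mul, mul_assoc, tsum_mul_left]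
  bound := by
    refine ⟨(1 - ‖z‖)⁻¹, fun f hf => (tsum_of_norm_bounded (hasSum_discValue_bound hz f)
      (norm_discValue_term_le f z)).trans ?_⟩
    rw [mul_comm]
    have : 0 < 1 - ‖z‖ := by linarith
    gcongr
    exact integral_norm_le_eLpNorm hf

lemma discValue_coord_zpow {j : ℤ} (hj : 0 ≤ j) (z : ℂ) :
    discValue (fun x => coord x ^ j) z = z ^ j := by
  lift j to ℕ using hj
  rw [discValue, tsum_eq_single j]
  · rw [fourierCoeff_coord_zpow, if_pos rfl, one_mul, zpow_natCast]
  · intro k hk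
    rw [fourierCoeff_coord_zpow, if_neg (by exact_mod_cast hk), zero_mul]

variable {P : Lp ℂ p torusMeasure →L[ℂ] Lp ℂ p torusMeasure}

/-- α exchanges the disc and its exterior; on monomials this is the coanalyticity of α^j for j ≥ 0.
-/
lemma memHardyConj_comp_shift (hP : IsAnalyticProjection p P) (hp : p ≠ ∞) (hβ : 1 < ‖β‖)
    {f : Torus → ℂ} (hf : MemHardy p f) : MemHardyConj p fun x => f (shift β x) :=
  ⟨memLp_comp_shift hβ hf.1, fun n hn =>
    (isBoundedFunctional_fourierCoeff_comp_shift hβ n).eq_zero_of_memHardy hP hp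
      (fun _ hj => (fourierCoeff_coord_shift_zpow hβ hj).1 n hn) hf⟩

lemma memHardy_comp_shift (hP : IsAnalyticProjection p P) (hp : p ≠ ∞) (hβ : 1 < ‖β‖)
    {f : Torus → ℂ} (hf : MemHardyConj p f) : MemHardy p fun x => f (shift β x) :=
  ⟨memLp_comp_shift hβ hf.1, fun n hn =>
    (isBoundedFunctional_fourierCoeff_comp_shift hβ n).eq_zero_of_memHardyConj hP hp
      (fun _ hj => fourierCoeff_coord_shift_zpow_of_nonpos hβ hj hn) hf⟩

/-- The value of f∘α at ∞ is f(α(∞)). This is where the point 1/conj β of the signature comes from.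
-/
lemma fourierCoeff_zero_comp_shift (hP : IsAnalyticProjection p P) (hp : p ≠ ∞) (hβ : 1 < ‖β‖)
    {f : Torus → ℂ} (hf : MemHardy p f) :
    fourierCoeff (fun x => f (shift β x)) 0 = discValue f (1 / conj β) := by
  have hz : ‖1 / conj β‖ < 1 := by
    rw [norm_div, norm_one, RCLike.norm_conj, one_div]
    exact inv_lt_one_of_one_lt₀ hβ
  have h := ((isBoundedFunctional_fourierCoeff_comp_shift (p := p) hβ 0).sub_const_mul
    (isBoundedFunctional_discValue hz) 1).eq_zero_of_memHardy hP hp (fun j hj => by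
      rw [(fourierCoeff_coord_shift_zpow hβ hj).2, discValue_coord_zpow hj, one_mul, sub_self]) hf
  rwa [one_mul, sub_eq_zero] at h

end Alpha

/-! ### Bases of symmetrized systems -/

section LinearAlgebra

variable {E : Type*} [AddCommGroup E] [Module ℂ E]

lemma exists_dual_family {e : ℕ → E} (he : LinearIndependent ℂ e) :
    ∃ δ : ℕ → Module.Dual ℂ E, ∀ i j, δ i (e j) = if j = i then 1 else 0 := by
  obtain ⟨L, hL⟩ := LinearMap.exists_leftInverse_of_injective (Finsupp.linearCombination ℂ e)
    (LinearMap.ker_eq_bot.mpr he)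
  refine ⟨fun i => Finsupp.lapply i ∘ₗ L, fun i j => ?_⟩
  have h : L (e j) = Finsupp.single j 1 := by
    simpa using LinearMap.congr_fun hL (Finsupp.single j 1)
  rw [LinearMap.comp_apply, h, Finsupp.lapply_apply, Finsupp.single_apply]

lemma LinearIndependent.isBasisOf_range {ι : Type*} [Fintype ι] {v : ι → E}
    (hv : LinearIndependent ℂ v) {B : Set E} (hB : B = Set.range v) {V : Submodule ℂ E}
    (hV : Submodule.span ℂ B = V) :
    IsBasisOf B V ∧ Module.finrank ℂ V = Fintype.card ι := by
  subst hB hV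
  exact ⟨⟨hv.linearIndepOn_id, rfl⟩, finrank_span_eq_card hv⟩

/-- The reversal j ↦ 2m-1-j has no fixed point, and since τ² = 1 the vectors attached to j and its
mirror are proportional. One vector per pair remains, detected by the coordinate at m-k-1. -/
lemma isBasisOf_even {e : ℕ → E} (he : LinearIndependent ℂ e) {τ : ℂ} (hτ : τ * τ = 1) (m : ℕ) :
    IsBasisOf {h | ∃ k < m, h = e (m - k - 1) + τ • e (m + k)}
        (Submodule.span ℂ {h | ∃ j < 2 * m, h = e j + τ • e (2 * m - 1 - j)}) ∧
      Module.finrank ℂ (Submodule.span ℂ {h | ∃ j < 2 * m, h = e j + τ • e (2 * m - 1 - j)}) =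
        m := by
  obtain ⟨δ, hδ⟩ := exists_dual_family he
  have hv : LinearIndependent ℂ fun k : Fin m => e (m - k - 1) + τ • e (m + k) := by
    refine LinearIndependent.of_pairwise_dual_eq_zero_one _ (fun k => δ (m - k - 1)) ?_ ?_
    · intro k l hkl
      have := Fin.val_ne_of_ne hkl
      simp only [map_add, map_smul, hδ]
      rw [if_neg (by omega), if_neg (by omega)]
      simp
    · intro k
      simp only [map_add, map_smul, hδ]
      rw [if_pos trivial, if_neg (by omega)]
      simp
  have h := LinearIndependent.isBasisOf_range hv
    (B := {h | ∃ k < m, h = e (m - k - 1) + τ • e (m + k)})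
    (V := Submodule.span ℂ {h | ∃ j < 2 * m, h = e j + τ • e (2 * m - 1 - j)}) ?_ ?_
  · simpa using h
  · ext h
    constructor
    · rintro ⟨k, hk, rfl⟩
      exact ⟨⟨k, hk⟩, rfl⟩
    · rintro ⟨k, rfl⟩
      exact ⟨k, k.2, rfl⟩
  · refine le_antisymm (Submodule.span_mono ?_) (Submodule.span_le.mpr ?_)
    · rintro _ ⟨k, hk, rfl⟩
      exact ⟨m - k - 1, by omega, by rw [show 2 * m - 1 - (m - k - 1) = m + k by omega]⟩
    · rintro _ ⟨j, hj, rfl⟩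
      by_cases hjm : j < m
      · refine Submodule.subset_span ⟨m - 1 - j, by omega, ?_⟩
        rw [show m - (m - 1 - j) - 1 = j by omega, show m + (m - 1 - j) = 2 * m - 1 - j by omega]
      · have hmem : e (2 * m - 1 - j) + τ • e j ∈
            Submodule.span ℂ {h | ∃ k < m, h = e (m - k - 1) + τ • e (m + k)} := by
          refine Submodule.subset_span ⟨j - m, by omega, ?_⟩
          rw [show m - (j - m) - 1 = 2 * m - 1 - j by omega, show m + (j - m) = j by omega]
        have := Submodule.smul_mem _ τ hmem
        rwa [smul_add, smul_smul, hτ, one_smul, add_comm] at this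

lemma span_odd (e : ℕ → E) {τ : ℂ} (hτ : τ * τ = 1) (m : ℕ) :
    Submodule.span ℂ ({h | ∃ k ≤ m, h = e (m + k) + τ • e (m - k)} \ {0}) =
      Submodule.span ℂ {h | ∃ j < 2 * m + 1, h = e j + τ • e (2 * m - j)} := by
  rw [Submodule.span_sdiff_singleton_zero]
  refine le_antisymm (Submodule.span_mono ?_) (Submodule.span_le.mpr ?_)
  · rintro _ ⟨k, hk, rfl⟩
    exact ⟨m + k, by omega, by rw [show 2 * m - (m + k) = m - k by omega]⟩
  · rintro _ ⟨j, hj, rfl⟩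
    by_cases hjm : m ≤ j
    · refine Submodule.subset_span ⟨j - m, by omega, ?_⟩
      rw [show m + (j - m) = j by omega, show m - (j - m) = 2 * m - j by omega]
    · have hmem : e (2 * m - j) + τ • e j ∈
          Submodule.span ℂ {h | ∃ k ≤ m, h = e (m + k) + τ • e (m - k)} := by
        refine Submodule.subset_span ⟨m - j, by omega, ?_⟩
        rw [show m + (m - j) = 2 * m - j by omega, show m - (m - j) = j by omega]
      have := Submodule.smul_mem _ τ hmem
      rwa [smul_add, smul_smul, hτ, one_smul, add_comm] at this

/-- The reversal j ↦ 2m-j fixes m, where the vector is (1 + τ) e_m. It adds a dimension for τ = 1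
and is the removed zero for τ = -1, which accounts for (1 + τ)/2. -/
lemma isBasisOf_odd {e : ℕ → E} (he : LinearIndependent ℂ e) {τ : ℂ} (hτ : τ * τ = 1) (m : ℕ) :
    IsBasisOf ({h | ∃ k ≤ m, h = e (m + k) + τ • e (m - k)} \ {0})
        (Submodule.span ℂ {h | ∃ j < 2 * m + 1, h = e j + τ • e (2 * m - j)}) ∧
      (Module.finrank ℂ
        (Submodule.span ℂ {h | ∃ j < 2 * m + 1, h = e j + τ • e (2 * m - j)}) : ℂ) =
        m + (1 + τ) / 2 := by
  obtain ⟨δ, hδ⟩ := exists_dual_family he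
  have hspan := span_odd e hτ m
  obtain rfl | rfl : τ = 1 ∨ τ = -1 := mul_self_eq_one_iff.mp hτ
  -- The weight 1/2 at k = 0 compensates for the middle vector being 2 e_m.
  · have hd : ∀ k l : Fin (m + 1), ((if (k : ℕ) = 0 then (1 / 2 : ℂ) else 1) • δ (m + k))
        (e (m + l) + (1 : ℂ) • e (m - l)) = if k = l then 1 else 0 := by
      intro k l
      simp only [map_add, map_smul, hδ, LinearMap.smul_apply, smul_eq_mul, Fin.ext_iff]
      split_ifs <;> first | omega | norm_num
    have hv : LinearIndependent ℂ fun k : Fin (m + 1) => e (m + k) + (1 : ℂ) • e (m - k) :=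
      LinearIndependent.of_pairwise_dual_eq_zero_one _
        (fun k => (if (k : ℕ) = 0 then (1 / 2 : ℂ) else 1) • δ (m + k))
        (fun k l hkl => by simp only [hd, if_neg hkl]) (fun k => by simp only [hd, if_true])
    have h := LinearIndependent.isBasisOf_range hv ?_ hspan
    · refine ⟨h.1, ?_⟩
      rw [h.2, Fintype.card_fin]
      push_cast
      ring
    · ext h
      constructor
      · rintro ⟨⟨k, hk, rfl⟩, -⟩
        exact ⟨⟨k, by omega⟩, rfl⟩
      · rintro ⟨k, rfl⟩
        exact ⟨⟨k, by omega, rfl⟩, hv.ne_zero k⟩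
  -- The index is shifted by one because k = 0 gives the zero vector.
  · have hv : LinearIndependent ℂ fun k : Fin m => e (m + (k + 1)) + (-1 : ℂ) • e (m - (k + 1)) := by
      refine LinearIndependent.of_pairwise_dual_eq_zero_one _ (fun k => δ (m + (k + 1))) ?_ ?_
      · intro k l hkl
        have := Fin.val_ne_of_ne hkl
        simp only [map_add, map_smul, hδ]
        rw [if_neg (by omega), if_neg (by omega)]
        simp
      · intro k
        simp only [map_add, map_smul, hδ]
        rw [if_pos trivial, if_neg (by omega)]
        simp
    have h := LinearIndependent.isBasisOf_range hv ?_ hspan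
    · refine ⟨h.1, ?_⟩
      rw [h.2, Fintype.card_fin]
      ring
    · ext h
      constructor
      · rintro ⟨⟨k, hk, rfl⟩, hne⟩
        obtain _ | k := k
        · simp at hne
        · exact ⟨⟨k, by omega⟩, rfl⟩
      · rintro ⟨k, rfl⟩
        exact ⟨⟨k + 1, by omega, rfl⟩, hv.ne_zero k⟩

end LinearAlgebra

/-! ### Systems `w u^j` in `L^p` -/

section PolynomialSystem

variable {p : ℝ≥0∞} {w u : Torus → ℂ}

open Polynomial in
/-- The linear map `r ↦ w (r ∘ u)` from polynomials to `L^p`. -/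
def polyLp (hw : MemLp w p torusMeasure) (hu : Continuous u) : ℂ[X] →ₗ[ℂ] Lp ℂ p torusMeasure where
  toFun r := (memLp_continuous_mul (r.continuous.comp hu) hw).toLp _
  map_add' r s := by
    rw [← MemLp.toLp_add]
    apply MemLp.toLp_congr
    exact Filter.Eventually.of_forall fun x => by simp [add_mul]
  map_smul' c r := by
    rw [RingHom.id_apply, ← MemLp.toLp_const_smul]
    apply MemLp.toLp_congr
    exact Filter.Eventually.of_forall fun x => by simp [mul_assoc]

lemma coeFn_polyLp (hw : MemLp w p torusMeasure) (hu : Continuous u) (r : Polynomial ℂ) :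
    polyLp hw hu r =ᵐ[torusMeasure] fun x => r.eval (u x) * w x :=
  MemLp.coeFn_toLp (memLp_continuous_mul (r.continuous.comp hu) hw)

lemma coeFn_polyLp_X_pow (hw : MemLp w p torusMeasure) (hu : Continuous u) (j : ℕ) :
    polyLp hw hu (.X ^ j) =ᵐ[torusMeasure] fun x => w x * u x ^ j := by
  filter_upwards [coeFn_polyLp hw hu (.X ^ j)] with x hx
  rw [hx, Polynomial.eval_pow, Polynomial.eval_X, mul_comm]

instance infinite_torus : Infinite Torus :=
  have : Infinite (Set.Ico (0 : ℝ) (0 + 2 * π)) :=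
    (Set.Ico_infinite (by linarith [Real.pi_pos])).to_subtype
  Infinite.of_injective _ (AddCircle.equivIco (2 * π) 0).symm.injective

/-- If w (r∘u) = 0, then r∘u vanishes almost everywhere, by continuity everywhere, so r has
infinitely many roots. -/
lemma linearIndependent_polyLp (hw : MemLp w p torusMeasure) (hu : Continuous u)
    (hw0 : ∀ᵐ x ∂torusMeasure, w x ≠ 0) (hinj : Function.Injective u) :
    LinearIndependent ℂ fun j : ℕ => polyLp hw hu (.X ^ j) := by
  have hX : LinearIndependent ℂ fun j : ℕ => (.X ^ j : Polynomial ℂ) := by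
    simpa [Polynomial.coe_basisMonomials, Polynomial.monomial_one_right_eq_X_pow] using
      (Polynomial.basisMonomials ℂ).linearIndependent
  refine hX.map' _ (LinearMap.ker_eq_bot'.mpr fun r hr => ?_)
  have h0 : (fun x => r.eval (u x)) =ᵐ[torusMeasure] fun _ => (0 : ℂ) := by
    have h1 := coeFn_polyLp hw hu r
    rw [hr] at h1
    filter_upwards [h1, Lp.coeFn_zero ℂ p torusMeasure, hw0] with x h1 h2 h3
    rw [h2] at h1
    exact (mul_eq_zero.mp h1.symm).resolve_right h3
  have h1 : (fun x => r.eval (u x)) = fun _ => 0 :=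
    (Continuous.ae_eq_iff_eq torusMeasure (r.continuous.comp hu) continuous_const).mp h0
  refine Polynomial.eq_zero_of_infinite_isRoot r
    ((Set.infinite_range_of_injective hinj).mono ?_)
  rintro _ ⟨x, rfl⟩
  exact congrFun h1 x

end PolynomialSystem

lemma injective_chi {β : ℂ} (hβ : 1 < ‖β‖) : Function.Injective (chi β) := by
  intro x y h
  rw [chi_eq hβ, chi_eq hβ, div_left_inj' (lam_ne_zero hβ), sub_left_inj] at h
  exact coord_injective (mul_left_cancel₀ (conj_ne_zero_of_one_lt_norm hβ) h)

lemma ae_eq_sum_of_fourierCoeff_eq_zero {f : Torus → ℂ} (hf : Integrable f torusMeasure) {n : ℕ}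
    (h1 : ∀ k : ℤ, k < 0 → fourierCoeff f k = 0) (h2 : ∀ k : ℤ, n ≤ k → fourierCoeff f k = 0) :
    f =ᵐ[torusMeasure] fun x => ∑ j ∈ Finset.range n, fourierCoeff f j * coord x ^ (j : ℤ) := by
  have hi : ∀ j : ℕ, Integrable (fun x => fourierCoeff f j * coord x ^ (j : ℤ)) torusMeasure :=
    fun j => Continuous.integrable_of_hasCompactSupport
      (continuous_const.mul (continuous_coord_zpow _)) (HasCompactSupport.of_compactSpace _)
  refine ae_eq_of_fourierCoeff_eq hf (integrable_finsetSum _ fun j _ => hi j) fun k => ?_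
  have e : (fun x => ∑ j ∈ Finset.range n, fourierCoeff f j * coord x ^ (j : ℤ)) =
      ∑ j ∈ Finset.range n, fun x => fourierCoeff f j * coord x ^ (j : ℤ) := by
    funext x
    rw [Finset.sum_apply]
  rw [e, fourierCoeff.sum _ (fun (j : ℕ) x => fourierCoeff f j * coord x ^ (j : ℤ)) fun j _ => hi j,
    Finset.sum_apply]
  simp_rw [fourierCoeff.const_mul, fourierCoeff_coord_zpow]
  by_cases hk : 0 ≤ k ∧ k < n
  · lift k to ℕ using hk.1
    rw [Finset.sum_eq_single_of_mem k (Finset.mem_range.mpr (by omega))]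
    · simp
    · intro j _ hj
      rw [if_neg (by exact_mod_cast hj.symm), mul_zero]
  · have hz : fourierCoeff f k = 0 := by
      by_cases hk0 : k < 0
      · exact h1 k hk0
      · exact h2 k (by omega)
    rw [hz]
    refine (Finset.sum_eq_zero fun j hj => ?_).symm
    have := Finset.mem_range.mp hj
    rw [if_neg (by omega), mul_zero]

/-! ### The kernel of the Toeplitz operator -/

section Kernel

variable {p : ℝ≥0∞} [hp1 : Fact (1 ≤ p)] {g : Lp ℂ ∞ torusMeasure}

lemma coeFn_mulOp (g : Lp ℂ ∞ torusMeasure) (f : Lp ℂ p torusMeasure) :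
    mulOp p g f =ᵐ[torusMeasure] fun x => g x * f x :=
  (ContinuousLinearMap.mul ℂ ℂ).coeFn_holder g f

/-- A Toeplitz operator with finite-dimensional kernel can only be built from an honest
projection, since the default value of `analyticProjection` is zero. -/
lemma isAnalyticProjection_of_finiteDimensional_ker
    (h : FiniteDimensional ℂ (toeplitz p g).ker) :
    IsAnalyticProjection p (analyticProjection p) := by
  classical
  by_cases hex : ∃ P, IsAnalyticProjection p P
  · rw [analyticProjection, dif_pos hex]
    exact hex.choose_spec
  · have h0 : analyticProjection p = 0 := by rw [analyticProjection, dif_neg hex]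
    have hmem : ∀ φ : hardy p, φ ∈ (toeplitz p g).ker := by
      intro φ
      refine LinearMap.mem_ker.mpr (Subtype.ext ?_)
      change analyticProjection p (mulOp p g φ) = 0
      rw [h0]
      rfl
    -- The monomials t^j, realized with weight 1, form an infinite independent family in the kernel.
    have hw : MemLp (fun _ : Torus => (1 : ℂ)) p torusMeasure := memLp_const 1
    have hli := linearIndependent_polyLp hw continuous_coord
      (Filter.Eventually.of_forall fun _ => one_ne_zero) coord_injective
    have hhardy : ∀ j : ℕ, polyLp hw continuous_coord (.X ^ j) ∈ hardy p := by
      intro j n hn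
      rw [fourierCoeff_congr_ae (coeFn_polyLp_X_pow hw continuous_coord j)]
      simp only [one_mul, ← zpow_natCast]
      rw [fourierCoeff_coord_zpow, if_neg (by omega)]
    let v : ℕ → (toeplitz p g).ker := fun j => ⟨⟨_, hhardy j⟩, hmem _⟩
    have hv : LinearIndependent ℂ v :=
      LinearIndependent.of_comp ((hardy p).subtype ∘ₗ (toeplitz p g).ker.subtype) hli
    exact absurd hv.finite_of_isNoetherian (not_finite_iff_infinite.mpr inferInstance)

lemma mem_ker_toeplitz_iff (hP : IsAnalyticProjection p (analyticProjection p)) (φ : hardy p) :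
    φ ∈ (toeplitz p g).ker ↔
      ∀ n : ℤ, 0 ≤ n → fourierCoeff (fun x => g x * (φ : Lp ℂ p torusMeasure) x) n = 0 := by
  rw [← fourierCoeff_congr_ae (coeFn_mulOp g (φ : Lp ℂ p torusMeasure)),
    ← hP.apply_eq_zero_iff]
  exact LinearMap.mem_ker.trans Subtype.ext_iff

lemma memHardy_mul_chi_pow {β : ℂ} (hβ : 1 < ‖β‖) {f : Torus → ℂ} (hf : MemHardy p f) (j : ℕ) :
    MemHardy p fun x => f x * chi β x ^ j := by
  induction j with
  | zero => simpa using hf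
  | succ j ih =>
    have hi := ih.1.integrable hp1.out
    have e : (fun x => f x * chi β x ^ (j + 1)) = fun x => (lam β)⁻¹ *
        (conj β * (coord x ^ (1 : ℤ) * (f x * chi β x ^ j)) - f x * chi β x ^ j) := by
      funext x
      rw [pow_succ, chi_eq hβ, zpow_one]
      ring
    refine ⟨?_, fun n hn => ?_⟩
    · have := memLp_continuous_mul (continuous_chi hβ) ih.1
      convert this using 2
      ring
    · rw [e, fourierCoeff.const_mul, fourierCoeff_fun_sub
        ((integrable_bdd_mul (continuous_coord_zpow 1) hi).const_mul _) hi,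
        fourierCoeff.const_mul, fourierCoeff_coord_mul, ih.2 _ (by omega), ih.2 _ hn]
      ring

variable {q : ℝ≥0∞} {β : ℂ} {gm gp : Torus → ℂ} {n : ℕ}

/-- The system `g₊⁻¹ χ^j` in `L^p`. -/
def chiSystem (hβ : 1 < ‖β‖) (hgp : MemHardy p fun x => (gp x)⁻¹) (j : ℕ) : Lp ℂ p torusMeasure :=
  polyLp hgp.1 (continuous_chi hβ) (.X ^ j)

omit hp1 in
lemma coeFn_chiSystem (hβ : 1 < ‖β‖) (hgp : MemHardy p fun x => (gp x)⁻¹) (j : ℕ) :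
    chiSystem hβ hgp j =ᵐ[torusMeasure] fun x => (gp x)⁻¹ * chi β x ^ j :=
  coeFn_polyLp_X_pow _ _ j

lemma chiSystem_mem_hardy (hβ : 1 < ‖β‖) (hgp : MemHardy p fun x => (gp x)⁻¹) (j : ℕ) :
    chiSystem hβ hgp j ∈ hardy p := fun n hn => by
  rw [fourierCoeff_congr_ae (coeFn_chiSystem hβ hgp j)]
  exact (memHardy_mul_chi_pow hβ hgp j).2 n hn

namespace IsWienerHopf

/-- The minus factor relative to `χ`: `g = (g₋ α₋^{-n}) χ^{-n} g₊`. -/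
lemma factorization_chi (hfac : IsWienerHopf p q g gm (-n) gp) (hβ : 1 < ‖β‖) :
    ∀ᵐ x ∂torusMeasure,
      g x = (alphaMinus β (coord x))⁻¹ ^ n * gm x * (chi β x)⁻¹ ^ n * gp x := by
  filter_upwards [hfac.factorization] with x hx
  have h1 := coord_ne_zero x
  have h2 := chi_ne_zero hβ x
  rw [hx, alphaMinus_coord β, zpow_neg, zpow_natCast, mul_inv, inv_inv, mul_pow, inv_pow, inv_pow]
  field_simp

/-- g g₊⁻¹ χ^j = α₋^{-n} χ^{-(n-j)} g₋ is coanalytic, and χ⁻¹ vanishes at infinity, so j < n also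
kills the constant coefficient. -/
lemma chiSystem_mem_ker (hfac : IsWienerHopf p q g gm (-n) gp) (hβ : 1 < ‖β‖)
    (hP : IsAnalyticProjection p (analyticProjection p)) {j : ℕ} (hj : j < n) :
    (⟨chiSystem hβ hfac.plus_inv_mem j, chiSystem_mem_hardy hβ hfac.plus_inv_mem j⟩ : hardy p) ∈
      (toeplitz p g).ker := by
  rw [mem_ker_toeplitz_iff hP]
  have e : (fun x => g x * chiSystem hβ hfac.plus_inv_mem j x) =ᵐ[torusMeasure]
      fun x => ((alphaMinus β (coord x))⁻¹ ^ n * (chi β x)⁻¹ ^ (n - j)) * gm x := by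
    filter_upwards [hfac.factorization_chi hβ, coeFn_chiSystem hβ hfac.plus_inv_mem j,
      hfac.plus_ne_zero] with x h1 h2 h3
    have h4 := chi_ne_zero hβ x
    obtain ⟨k, rfl⟩ := Nat.exists_eq_add_of_lt hj
    rw [h1, h2, show j + k + 1 - j = k + 1 by omega, inv_pow (chi β x), inv_pow (chi β x)]
    field_simp
    ring
  have hm := ((isConjMultiplier_alphaMinus_inv hβ).pow n).mul
    ((isConjMultiplier_chi_inv hβ).pow (n - j))
  intro k hk
  refine (congrFun (fourierCoeff_congr_ae e) k).trans ?_
  rcases hk.eq_or_lt with rfl | hk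
  · rw [hm.fourierCoeff_zero hfac.minus_mem, zero_pow (by omega)]
    ring
  · exact (hm.memHardyConj hfac.minus_mem).2 k hk

lemma mem_span_chiSystem (hfac : IsWienerHopf p q g gm (-n) gp) (hβ : 1 < ‖β‖)
    [hpq : p.HolderConjugate q] (hp : p ≠ ∞) (hP : IsAnalyticProjection p (analyticProjection p))
    {φ : hardy p} (hφ : φ ∈ (toeplitz p g).ker) :
    (φ : Lp ℂ p torusMeasure) ∈
      Submodule.span ℂ (Set.range fun j : Fin n => chiSystem hβ hfac.plus_inv_mem j) := by
  rw [mem_ker_toeplitz_iff hP] at hφ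
  obtain ⟨f, hf⟩ := φ
  have hfH : MemHardy p f := ⟨Lp.memLp f, hf⟩
  have hgf : MemHardyConj p fun x => g x * f x :=
    ⟨(memLp_congr_ae (coeFn_mulOp g f)).mp (Lp.memLp _), fun n hn => hφ n hn.le⟩
  have hu : ∀ k : ℤ, k < 0 → fourierCoeff (fun x => f x * gp x) k = 0 := fun k hk =>
    fourierCoeff_mul_of_memHardy hP hp hfH hfac.plus_mem hk
  have hu' : ∀ k : ℤ, n ≤ k → fourierCoeff (fun x => f x * gp x) k = 0 := by
    have e : (fun x => f x * gp x) =ᵐ[torusMeasure]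
        fun x => coord x ^ (n : ℤ) * ((g x * f x) * (gm x)⁻¹) := by
      filter_upwards [hfac.factorization, hfac.minus_ne_zero] with x h1 h2
      have h3 := coord_ne_zero x
      rw [h1, zpow_neg]
      field_simp
    intro k hk
    rw [fourierCoeff_congr_ae e, fourierCoeff_coord_mul]
    rcases hk.eq_or_lt with rfl | hk
    -- The borderline k = n: the constant term of the product contains the factor (g f)^₀, which is
    -- zero because f is in the kernel.
    · rw [sub_self, fourierCoeff_zero_mul_of_memHardyConj hP hp hgf hfac.minus_inv_mem,
        hφ 0 le_rfl, zero_mul]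
    · exact fourierCoeff_mul_of_memHardyConj hP hp hgf hfac.minus_inv_mem (by omega)
  have hsum : (fun x => f x * gp x) =ᵐ[torusMeasure]
      fun x => ∑ j ∈ Finset.range n, fourierCoeff (fun x => f x * gp x) j * coord x ^ (j : ℤ) :=
    ae_eq_sum_of_fourierCoeff_eq_zero (integrable_mul_of_memLp hfH.1 hfac.plus_mem.1) hu hu'
  -- The inverse of the affine relation between χ and t, which turns a polynomial in t into one in χ
  -- without raising the degree.
  let ℓ : Polynomial ℂ := .C (lam β / conj β) * .X + .C (1 / conj β)
  have hℓ : ∀ x, ℓ.eval (chi β x) = coord x := by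
    intro x
    have h1 := lam_ne_zero hβ
    have h2 := conj_ne_zero_of_one_lt_norm hβ
    simp only [ℓ, Polynomial.eval_add, Polynomial.eval_mul, Polynomial.eval_C, Polynomial.eval_X,
      chi_eq hβ]
    field_simp
    ring
  let r : Polynomial ℂ :=
    ∑ j ∈ Finset.range n, .C (fourierCoeff (fun x => f x * gp x) j) * ℓ ^ j
  have hr : f = polyLp hfac.plus_inv_mem.1 (continuous_chi hβ) r := by
    refine Lp.ext ?_
    filter_upwards [hsum, coeFn_polyLp hfac.plus_inv_mem.1 (continuous_chi hβ) r,
      hfac.plus_ne_zero] with x h1 h2 h3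
    rw [h2, eq_mul_inv_iff_mul_eq₀ h3, h1, Polynomial.eval_finsetSum]
    simp [hℓ]
  have hℓ1 : ℓ.natDegree ≤ 1 := Polynomial.natDegree_linear_le
  have hdeg : r ∈ Polynomial.degreeLT ℂ n := by
    refine Submodule.sum_mem _ fun j hj => Polynomial.mem_degreeLT.mpr ?_
    have h1 : (.C (fourierCoeff (fun x => f x * gp x) j) * ℓ ^ j).natDegree ≤ j :=
      (Polynomial.natDegree_C_mul_le _ _).trans
        (by simpa using Polynomial.natDegree_pow_le_of_le j hℓ1)
    refine (Polynomial.degree_le_of_natDegree_le h1).trans_lt ?_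
    exact_mod_cast Finset.mem_range.mp hj
  classical
  rw [Polynomial.degreeLT_eq_span_X_pow] at hdeg
  change f ∈ _
  rw [hr]
  refine Submodule.span_mono ?_ (Submodule.apply_mem_span_image_of_mem_span
    (polyLp hfac.plus_inv_mem.1 (continuous_chi hβ)) hdeg)
  rintro _ ⟨s, hs, rfl⟩
  simp only [Finset.coe_image, Set.mem_image, Finset.coe_range, Set.mem_Iio] at hs
  obtain ⟨j, hj, rfl⟩ := hs
  exact ⟨⟨j, hj⟩, rfl⟩

end IsWienerHopf

end Kernel

/-! ### The signature and the flip -/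

namespace IsWienerHopf

variable {p q : ℝ≥0∞} [hp1 : Fact (1 ≤ p)] {g : Lp ℂ ∞ torusMeasure} {β : ℂ}
  {gm gp : Torus → ℂ} {n : ℕ}

/-- For `α`-matching `g` the plus factor and the shifted minus factor are proportional, and the
constant is the signature. -/
lemma shifted_minus_mul_plus (hfac : IsWienerHopf p q g gm (-n) gp) (hβ : 1 < ‖β‖)
    [hpq : p.HolderConjugate q] (hp : p ≠ ∞) (hP : IsAnalyticProjection p (analyticProjection p))
    (hg : IsMatching β g) :
    (∀ᵐ x ∂torusMeasure, (alphaMinus β (coord (shift β x)))⁻¹ ^ n * gm (shift β x) * gp x =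
        signature β n gp) ∧
      signature β n gp * signature β n gp = 1 := by
  have : Fact (1 ≤ q) := ⟨hpq.symm.one_le⟩
  have hqmp := quasiMeasurePreserving_shift hβ
  -- This is G, the minus factor relative to χ; composition with α makes it analytic.
  have hG : MemHardyConj p fun x => (alphaMinus β (coord x))⁻¹ ^ n * gm x :=
    ((isConjMultiplier_alphaMinus_inv hβ).pow n).memHardyConj hfac.minus_mem
  have hGs := memHardy_comp_shift hP hp hβ hG
  have hGi : MemHardyConj q fun x => alphaMinus β (coord x) ^ n * (gm x)⁻¹ :=
    ((isConjMultiplier_alphaMinus hβ).pow n).memHardyConj hfac.minus_inv_mem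
  have hgs := memHardyConj_comp_shift hP hp hβ hfac.plus_inv_mem
  have hgm0 : fourierCoeff (fun x => (gm x)⁻¹) 0 = 1 := by
    have h1 := fourierCoeff_zero_mul_of_memHardyConj hP hp hfac.minus_mem hfac.minus_inv_mem
    have e : (fun x => gm x * (gm x)⁻¹) =ᵐ[torusMeasure] fun x => coord x ^ (0 : ℤ) := by
      filter_upwards [hfac.minus_ne_zero] with x hx
      rw [mul_inv_cancel₀ hx, zpow_zero]
    rw [fourierCoeff_congr_ae e, fourierCoeff_coord_zpow, if_pos rfl, hfac.minus_infty,
      one_mul] at h1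
    exact h1.symm
  have hs0 : fourierCoeff (fun x => (gp (shift β x))⁻¹ *
      (alphaMinus β (coord x) ^ n * (gm x)⁻¹)) 0 = signature β n gp := by
    rw [fourierCoeff_zero_mul_of_memHardyConj hP hp hgs hGi,
      ((isConjMultiplier_alphaMinus hβ).pow n).fourierCoeff_zero hfac.minus_inv_mem, hgm0, mul_one,
      fourierCoeff_zero_comp_shift hP hp hβ hfac.plus_inv_mem, signature, mul_comm]
  have hprod : ∀ᵐ x ∂torusMeasure,
      ((alphaMinus β (coord (shift β x)))⁻¹ ^ n * gm (shift β x) * gp x) *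
        ((alphaMinus β (coord x))⁻¹ ^ n * gm x * gp (shift β x)) = 1 := by
    filter_upwards [hg, hfac.factorization_chi hβ, hqmp.ae (hfac.factorization_chi hβ)]
      with x h1 h2 h3
    have h4 := chi_ne_zero hβ x
    have h5 : (chi β x)⁻¹ ^ n * (chi β (shift β x))⁻¹ ^ n = 1 := by
      rw [chi_shift hβ, inv_inv, ← mul_pow, inv_mul_cancel₀ h4, one_pow]
    rw [h2, h3] at h1
    rw [← h1]
    linear_combination (-((alphaMinus β (coord (shift β x)))⁻¹ ^ n * gm (shift β x) * gp x) *
        ((alphaMinus β (coord x))⁻¹ ^ n * gm x * gp (shift β x))) * h5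
  -- By the reciprocity just shown, the analytic product (G∘α) g₊ has a second expression (g₊∘α)⁻¹
  -- G⁻¹, which is coanalytic. Hence it is constant.
  have heq : (fun x => (alphaMinus β (coord (shift β x)))⁻¹ ^ n * gm (shift β x) * gp x)
      =ᵐ[torusMeasure] fun x => (gp (shift β x))⁻¹ * (alphaMinus β (coord x) ^ n * (gm x)⁻¹) := by
    filter_upwards [hprod] with x h
    rw [eq_inv_of_mul_eq_one_left h, mul_inv, mul_inv, inv_pow, inv_inv, mul_comm]
  have hconst : (fun x => (alphaMinus β (coord (shift β x)))⁻¹ ^ n * gm (shift β x) * gp x)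
      =ᵐ[torusMeasure] fun x => signature β n gp * coord x ^ (0 : ℤ) := by
    refine ae_eq_of_fourierCoeff_eq (integrable_mul_of_memLp hGs.1 hfac.plus_mem.1)
      (by simp) fun k => ?_
    rw [fourierCoeff.const_mul, fourierCoeff_coord_zpow]
    rcases lt_trichotomy k 0 with hk | rfl | hk
    · rw [if_neg hk.ne, mul_zero]
      exact fourierCoeff_mul_of_memHardy hP hp hGs hfac.plus_mem hk
    · rw [fourierCoeff_congr_ae heq, hs0, if_pos rfl, mul_one]
    · rw [fourierCoeff_congr_ae heq, if_neg hk.ne', mul_zero]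
      exact fourierCoeff_mul_of_memHardyConj hP hp hgs hGi hk
  simp only [zpow_zero, mul_one] at hconst
  refine ⟨hconst, ?_⟩
  -- Evaluate the constant at x and at α(x): by α∘α = id the two values are the reciprocal factors,
  -- so σ² = 1.
  obtain ⟨x, h1, h2, h3⟩ := (hconst.and ((hqmp.ae hconst).and hprod)).exists
  simp only [shift_shift hβ] at h1 h2
  rw [h1, h2] at h3
  exact h3

/-- On the kernel Q g φ = g φ, and J_α turns g e_j = G χ^{j-n} into χ⁻¹ (G∘α) χ^{n-j}, with G∘α = σ
g₊⁻¹. -/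
lemma kernelFlip_chiSystem (hfac : IsWienerHopf p q g gm (-n) gp) (hβ : 1 < ‖β‖)
    [hpq : p.HolderConjugate q] (hp : p ≠ ∞) (hP : IsAnalyticProjection p (analyticProjection p))
    (hg : IsMatching β g) {j : ℕ} (hj : j < n) :
    kernelFlip hβ p g ⟨_, hfac.chiSystem_mem_ker hβ hP hj⟩ =
      signature β n gp • chiSystem hβ hfac.plus_inv_mem (n - 1 - j) := by
  have hqmp := quasiMeasurePreserving_shift hβ
  set φ := chiSystem hβ hfac.plus_inv_mem j with hφ
  have hker : analyticProjection p (mulOp p g φ) = 0 :=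
    Subtype.ext_iff.mp (LinearMap.mem_ker.mp (hfac.chiSystem_mem_ker hβ hP hj))
  have h1 : kernelFlip hβ p g ⟨_, hfac.chiSystem_mem_ker hβ hP hj⟩ =
      weightedShift hβ p (mulOp p g φ) := by
    change weightedShift hβ p (coanalyticProjection p (mulOp p g (analyticProjection p φ))) = _
    rw [hP.apply_eq_self (chiSystem_mem_hardy hβ hfac.plus_inv_mem j), coanalyticProjection,
      sub_apply, hker, sub_zero]
    rfl
  rw [h1]
  refine Lp.ext ?_
  have h2 : weightedShift hβ p (mulOp p g φ) =ᵐ[torusMeasure]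
      fun x => (chi β x)⁻¹ * (mulOp p g φ) (shift β x) :=
    MemLp.coeFn_toLp (memLp_shiftOp hβ (Lp.memLp (mulOp p g φ)))
  filter_upwards [h2, hqmp.ae (coeFn_mulOp g φ),
    hqmp.ae (coeFn_chiSystem hβ hfac.plus_inv_mem j), hqmp.ae (hfac.factorization_chi hβ),
    (hfac.shifted_minus_mul_plus hβ hp hP hg).1, hfac.plus_ne_zero, hqmp.ae hfac.plus_ne_zero,
    Lp.coeFn_smul (signature β n gp) (chiSystem hβ hfac.plus_inv_mem (n - 1 - j)),
    coeFn_chiSystem hβ hfac.plus_inv_mem (n - 1 - j)] with x e1 e2 e3 e4 e5 e6 e7 e8 e9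
  have h4 := chi_ne_zero hβ x
  rw [e1, e2, hφ, e3, e4, e8, Pi.smul_apply, e9, ← e5, chi_shift hβ, inv_inv, smul_eq_mul]
  obtain ⟨k, rfl⟩ := Nat.exists_eq_add_of_lt hj
  rw [show j + k + 1 - 1 - j = k by omega, inv_pow (chi β x)]
  field_simp
  ring

lemma range_kernelProj (hfac : IsWienerHopf p q g gm (-n) gp) (hβ : 1 < ‖β‖)
    [hpq : p.HolderConjugate q] (hp : p ≠ ∞) (hP : IsAnalyticProjection p (analyticProjection p))
    (hg : IsMatching β g) (ε : ℂ) :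
    (kernelProj hβ p g ε).range = Submodule.span ℂ {h | ∃ j < n,
      h = chiSystem hβ hfac.plus_inv_mem j +
        (ε * signature β n gp) • chiSystem hβ hfac.plus_inv_mem (n - 1 - j)} := by
  let φ : Fin n → (toeplitz p g).ker := fun j => ⟨_, hfac.chiSystem_mem_ker hβ hP j.2⟩
  let J : (toeplitz p g).ker →ₗ[ℂ] Lp ℂ p torusMeasure :=
    (hardy p).subtype ∘ₗ (toeplitz p g).ker.subtype
  have hJ : Function.Injective J :=
    (hardy p).injective_subtype.comp (toeplitz p g).ker.injective_subtype
  have htop : Submodule.span ℂ (Set.range φ) = ⊤ := by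
    refine eq_top_iff.mpr fun ψ _ => ?_
    have h := hfac.mem_span_chiSystem hβ hp hP ψ.2
    have e : (Set.range fun j : Fin n => chiSystem hβ hfac.plus_inv_mem j) =
        J '' Set.range φ := by
      rw [← Set.range_comp]
      rfl
    rw [e, Submodule.span_image] at h
    obtain ⟨ψ', hψ', heq⟩ := h
    rwa [← hJ heq]
  have hφ : ∀ j : Fin n, kernelProj hβ p g ε (φ j) = (1 / 2 : ℂ) •
      (chiSystem hβ hfac.plus_inv_mem j +
        (ε * signature β n gp) • chiSystem hβ hfac.plus_inv_mem (n - 1 - j)) := by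
    intro j
    rw [mul_smul, ← hfac.kernelFlip_chiSystem hβ hp hP hg j.2]
    rfl
  rw [LinearMap.range_eq_map, ← htop, Submodule.map_span, ← Set.range_comp]
  refine le_antisymm (Submodule.span_le.mpr ?_) (Submodule.span_le.mpr ?_)
  · rintro _ ⟨j, rfl⟩
    rw [Function.comp_apply, hφ]
    exact Submodule.smul_mem _ _ (Submodule.subset_span ⟨j, j.2, rfl⟩)
  · rintro _ ⟨j, hj, rfl⟩
    have h := Submodule.smul_mem _ (2 : ℂ) (Submodule.subset_span (R := ℂ)
      (Set.mem_range_self (f := kernelProj hβ p g ε ∘ φ) ⟨j, hj⟩))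
    rw [Function.comp_apply, hφ, smul_smul] at h
    norm_num at h
    exact h

end IsWienerHopf

/-- Translates systems given by representatives of functions into linear combinations in L^p, to
which the abstract basis lemmas apply. -/
lemma ae_eq_chiSystem_add_iff {p : ℝ≥0∞} {β : ℂ} (hβ : 1 < ‖β‖) {gp : Torus → ℂ} [Fact (1 ≤ p)]
    (hgp : MemHardy p fun x => (gp x)⁻¹) (i j : ℕ) (τ : ℂ) (h : Lp ℂ p torusMeasure) :
    (h =ᵐ[torusMeasure] fun x => (gp x)⁻¹ * (chi β x ^ i + τ * chi β x ^ j)) ↔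
      h = chiSystem hβ hgp i + τ • chiSystem hβ hgp j := by
  have e : (chiSystem hβ hgp i + τ • chiSystem hβ hgp j : Lp ℂ p torusMeasure) =ᵐ[torusMeasure]
      fun x => (gp x)⁻¹ * (chi β x ^ i + τ * chi β x ^ j) := by
    filter_upwards [Lp.coeFn_add (chiSystem hβ hgp i) (τ • chiSystem hβ hgp j),
      Lp.coeFn_smul τ (chiSystem hβ hgp j), coeFn_chiSystem hβ hgp i, coeFn_chiSystem hβ hgp j]
      with x h1 h2 h3 h4
    rw [h1, Pi.add_apply, h2, Pi.smul_apply, h3, h4, smul_eq_mul]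
    ring
  exact ⟨fun h' => Lp.ext (h'.trans e.symm), fun h' => h' ▸ e⟩

lemma linearIndependent_chiSystem {p : ℝ≥0∞} {β : ℂ} (hβ : 1 < ‖β‖) {gp : Torus → ℂ}
    [Fact (1 ≤ p)] (hgp : MemHardy p fun x => (gp x)⁻¹) (h0 : ∀ᵐ x ∂torusMeasure, gp x ≠ 0) :
    LinearIndependent ℂ (chiSystem hβ hgp) :=
  linearIndependent_polyLp hgp.1 (continuous_chi hβ) (h0.mono fun _ => inv_ne_zero)
    (injective_chi hβ)

end ToeplitzHankel

end

theorem theorem4p3 (β : ℂ) (hβ : 1 < ‖β‖) (p q : ENNReal) [Fact (1 ≤ p)] (hp1 : 1 < p) (hp : p < ⊤)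
    (hpq : p.HolderConjugate q)
    (g : MeasureTheory.Lp ℂ ⊤ ToeplitzHankel.torusMeasure)
    (hg : ToeplitzHankel.IsMatching β g)
    (hF : (ToeplitzHankel.toeplitz p g).IsFredholm)
    (n : ℕ) (hn : 0 < n) (hind : (ToeplitzHankel.toeplitz p g).toLinearMap.index = n)
    (gm gp : ToeplitzHankel.Torus → ℂ)
    (hfac : ToeplitzHankel.IsWienerHopf p q g gm (-n) gp)
    (ε : ℂ) (hε : ε = 1 ∨ ε = -1) :
    (∀ m : ℕ, n = 2 * m →
      ToeplitzHankel.IsBasisOf (ToeplitzHankel.evenSystem β p gp m ε)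
        (ToeplitzHankel.kernelProj hβ p g ε).range ∧
      Module.finrank ℂ (ToeplitzHankel.kernelProj hβ p g ε).range = m) ∧
    (∀ m : ℕ, n = 2 * m + 1 →
      ToeplitzHankel.IsBasisOf (ToeplitzHankel.oddSystem β p gp m ε)
        (ToeplitzHankel.kernelProj hβ p g ε).range ∧
      (Module.finrank ℂ (ToeplitzHankel.kernelProj hβ p g ε).range : ℂ) =
        m + (1 + ε * ToeplitzHankel.signature β n gp) / 2) := by
  have hP := ToeplitzHankel.isAnalyticProjection_of_finiteDimensional_ker hF.finite_ker
  have hσ := (hfac.shifted_minus_mul_plus hβ hp.ne hP hg).2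
  -- Both signs are treated at once: only τ = εσ with τ² = 1 enters.
  have hτ : (ε * ToeplitzHankel.signature β n gp) * (ε * ToeplitzHankel.signature β n gp) = 1 := by
    have : ε * ε = 1 := mul_self_eq_one_iff.mpr hε
    linear_combination ToeplitzHankel.signature β n gp * ToeplitzHankel.signature β n gp * this + hσ
  have hli := ToeplitzHankel.linearIndependent_chiSystem hβ hfac.plus_inv_mem hfac.plus_ne_zero
  rw [hfac.range_kernelProj hβ hp.ne hP hg ε]
  constructor
  · rintro m rfl
    have h := ToeplitzHankel.isBasisOf_even hli hτ m
    -- The exponent pattern restricts the rewriting to the basis and leaves the spanning set of the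
    -- range untouched.
    simp only [← ToeplitzHankel.ae_eq_chiSystem_add_iff hβ hfac.plus_inv_mem (_ - _ - 1)] at h
    exact h
  · rintro m rfl
    have h := ToeplitzHankel.isBasisOf_odd hli hτ m
    simp only [← ToeplitzHankel.ae_eq_chiSystem_add_iff hβ hfac.plus_inv_mem (_ + _)] at h
    exact h
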